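/- Let $M$ be a connected smooth manifold of real dimension $2n$ with a Hermitian structure $(J,g)$: an integrable almost complex structure $J$ (vanishing Nijenhuis tensor) and a Riemannian metric $g$ with $g(JX,JY)=g(X,Y)$. Put $\omega(X,Y)=g(JX,Y)$ and let $\nabla^g$ be the Levi-Civita connection. Assume that $(M,J,g)$ is Vaisman with Lee form $\theta$: $\theta$ is a closed $1$-form with $d\omega=\theta\wedge\omega$ and $\nabla^g\theta=0$. Assume moreover that $\theta$ is not identically zero. Let $A$ be the vector field with $g(A,\cdot)=\theta$, and let $\nabla^b$ be the Bismut connection, given by $$g(\nabla^b_XY,Z)=g(\nabla^g_XY,Z)+\tfrac12\,d\omega(JX,JY,JZ).$$ Then $\nabla^bA=0$ and $\nabla^b(JA)=0$, and the holonomy group of $\nabla^b$ is contained in $\mathrm{U}(n-1)$, embedded in $\mathrm{U}(n)$ by $B\mapsto\mathrm{diag}(1,B)$. That is, for every $p\in M$ there is a unitary identification of $(T_pM,J_p,g_p)$ with $\mathbb{C}^n$ ($J_p$ becomes multiplication by $i$, and $g_p$ the real part of the standard Hermitian inner product) under which the parallel transport map $P_\gamma:T_pM\to T_pM$ of $\nabla^b$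 along every piecewise smooth loop $\gamma$ based at $p$ becomes a matrix $\mathrm{diag}(1,B)$ with $B\in\mathrm{U}(n-1)$. -/

import Mathlib

open Bundle Set FiberBundle VectorField
open scoped Manifold ContDiff Topology

noncomputable section

namespace BismutVaisman

variable {E : Type*} [NormedAddCommGroup E] [NormedSpace ℝ E] [FiniteDimensional ℝ E]
  {M : Type*} [TopologicalSpace M] [ChartedSpace E M]

/-- The tangent space of a manifold modelled on `E`. -/
local notation "𝓣" => TangentSpace 𝓘(ℝ, E)

section Metric

variable [RiemannianBundle (fun x : M ↦ TangentSpace 𝓘(ℝ, E) x)]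

/-! ### Connections on the tangent bundle of a Riemannian manifold -/

/-- The vector metrically dual to a covector. -/
def sharp (x : M) : (𝓣 x →L[ℝ] ℝ) →ₗ[ℝ] 𝓣 x :=
  haveI : FiniteDimensional ℝ (𝓣 x) := inferInstanceAs (FiniteDimensional ℝ E)
  haveI : CompleteSpace (𝓣 x) := FiniteDimensional.complete ℝ _
  { toFun := fun f ↦ (InnerProductSpace.toDual ℝ (𝓣 x)).symm f
    map_add' := fun f g ↦ by simp
    map_smul' := fun c f ↦ by simp }

lemma inner_sharp (x : M) (f : 𝓣 x →L[ℝ] ℝ) (w : 𝓣 x) : inner ℝ (sharp x f) w = f w := by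
  have : FiniteDimensional ℝ (𝓣 x) := inferInstanceAs (FiniteDimensional ℝ E)
  have : CompleteSpace (𝓣 x) := FiniteDimensional.complete ℝ _
  exact InnerProductSpace.toDual_symm_apply

variable [IsManifold 𝓘(ℝ, E) ∞ M]

/-- The properties of an expression `Φ x X Y Z` in vector fields which make
`g(∇_X Y, Z) x = Φ x X Y Z` the definition of a connection: it is tensorial in `X` and `Z`, and
additive and derivative-like in `Y`. -/
structure IsConnectionForm
    (Φ : ∀ x : M, (∀ y : M, 𝓣 y) → (∀ y : M, 𝓣 y) → (∀ y : M, 𝓣 y) → ℝ) : Prop where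
  tensorial_left : ∀ {x} {Y Z : ∀ y : M, 𝓣 y}, MDiffAt (T% Y) x → MDiffAt (T% Z) x →
    TensorialAt 𝓘(ℝ, E) E (fun X ↦ Φ x X Y Z) x
  tensorial_right : ∀ {x} {X Y : ∀ y : M, 𝓣 y}, MDiffAt (T% X) x → MDiffAt (T% Y) x →
    TensorialAt 𝓘(ℝ, E) E (fun Z ↦ Φ x X Y Z) x
  add : ∀ {x} {X Y Y' Z : ∀ y : M, 𝓣 y}, MDiffAt (T% X) x → MDiffAt (T% Y) x →
    MDiffAt (T% Y') x → MDiffAt (T% Z) x → Φ x X (Y + Y') Z = Φ x X Y Z + Φ x X Y' Z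
  leibniz : ∀ {x} {f : M → ℝ} {X Y Z : ∀ y : M, 𝓣 y}, MDiffAt f x → MDiffAt (T% X) x →
    MDiffAt (T% Y) x → MDiffAt (T% Z) x →
    Φ x X (f • Y) Z = f x * Φ x X Y Z + d% f x (X x) * inner ℝ (Y x) (Z x)

open scoped Classical in
/-- The underlying map of `connectionOfForm`: `covOfForm Φ hΦ Y x u` is `(∇_u Y)(x)`, with the
conventional value `0` at points where `Y` is not differentiable. -/
def covOfForm (Φ : ∀ x : M, (∀ y : M, 𝓣 y) → (∀ y : M, 𝓣 y) → (∀ y : M, 𝓣 y) → ℝ)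
    (hΦ : IsConnectionForm Φ) (Y : ∀ y : M, 𝓣 y) (x : M) : 𝓣 x →L[ℝ] 𝓣 x :=
  haveI : FiniteDimensional ℝ (𝓣 x) := inferInstanceAs (FiniteDimensional ℝ E)
  if hY : MDiffAt (T% Y) x then
    LinearMap.toContinuousLinearMap (sharp x ∘ₗ
      (TensorialAt.mkHom₂ (fun X Z ↦ Φ x X Y Z) x
        (fun _ hZ ↦ hΦ.tensorial_left hY hZ)
        (fun _ hX ↦ hΦ.tensorial_right hX hY)).toLinearMap)
  else 0

lemma inner_covOfForm {Φ : ∀ x : M, (∀ y : M, 𝓣 y) → (∀ y : M, 𝓣 y) → (∀ y : M, 𝓣 y) → ℝ}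
    (hΦ : IsConnectionForm Φ) {x : M} {X Y Z : ∀ y : M, 𝓣 y} (hX : MDiffAt (T% X) x)
    (hY : MDiffAt (T% Y) x) (hZ : MDiffAt (T% Z) x) :
    inner ℝ (covOfForm Φ hΦ Y x (X x)) (Z x) = Φ x X Y Z := by
  unfold covOfForm
  rw [dif_pos hY]
  change inner ℝ (sharp x (TensorialAt.mkHom₂ (fun X Z ↦ Φ x X Y Z) x _ _ (X x))) (Z x) = _
  rw [inner_sharp, TensorialAt.mkHom₂_apply _ _ hX hZ]

lemma isCovariantDerivativeOn_covOfForm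
    {Φ : ∀ x : M, (∀ y : M, 𝓣 y) → (∀ y : M, 𝓣 y) → (∀ y : M, 𝓣 y) → ℝ}
    (hΦ : IsConnectionForm Φ) :
    IsCovariantDerivativeOn E (covOfForm Φ hΦ) := by
  have ext_diff (x : M) (u : 𝓣 x) : MDiffAt (T% (extend E u)) x := mdifferentiableAt_extend ..
  have key {Y : ∀ y : M, 𝓣 y} {x : M} (hY : MDiffAt (T% Y) x) (u w : 𝓣 x) :
      inner ℝ (covOfForm Φ hΦ Y x u) w = Φ x (extend E u) Y (extend E w) := by
    simpa using inner_covOfForm hΦ (ext_diff x u) hY (ext_diff x w)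
  constructor
  · intro Y Y' x hY hY' _
    ext u
    refine ext_inner_right ℝ fun w ↦ ?_
    rw [key (mdifferentiableAt_add_section hY hY'), add_apply, inner_add_left,
      key hY, key hY', hΦ.add (ext_diff x u) hY hY' (ext_diff x w)]
  · intro Y f x hY hf _
    ext u
    refine ext_inner_right ℝ fun w ↦ ?_
    rw [key (hf.smul_section hY), hΦ.leibniz hf (ext_diff x u) hY (ext_diff x w), ← key hY]
    simp [inner_add_left, inner_smul_left]

/-- The connection `∇` determined by `g(∇_X Y, Z) x = Φ x X Y Z`. -/
def connectionOfForm (Φ : ∀ x : M, (∀ y : M, 𝓣 y) → (∀ y : M, 𝓣 y) → (∀ y : M, 𝓣 y) → ℝ)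
    (hΦ : IsConnectionForm Φ) : CovariantDerivative 𝓘(ℝ, E) E (𝓣 : M → Type _) where
  toFun := covOfForm Φ hΦ
  isCovariantDerivativeOnUniv := isCovariantDerivativeOn_covOfForm hΦ

lemma inner_connectionOfForm
    {Φ : ∀ x : M, (∀ y : M, 𝓣 y) → (∀ y : M, 𝓣 y) → (∀ y : M, 𝓣 y) → ℝ}
    (hΦ : IsConnectionForm Φ) {x : M} {X Y Z : ∀ y : M, 𝓣 y} (hX : MDiffAt (T% X) x)
    (hY : MDiffAt (T% Y) x) (hZ : MDiffAt (T% Z) x) :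
    inner ℝ (connectionOfForm Φ hΦ Y x (X x)) (Z x) = Φ x X Y Z :=
  inner_covOfForm hΦ hX hY hZ

/-! ### The Levi-Civita connection -/

/-- The right-hand side of the Koszul formula for `g(∇_X Y, Z)`. -/
def koszul (x : M) (X Y Z : ∀ y : M, 𝓣 y) : ℝ :=
  (1 / 2) * (d% (fun y ↦ inner ℝ (Y y) (Z y)) x (X x)
    + d% (fun y ↦ inner ℝ (X y) (Z y)) x (Y x)
    - d% (fun y ↦ inner ℝ (X y) (Y y)) x (Z x)
    + inner ℝ (mlieBracket 𝓘(ℝ, E) X Y x) (Z x)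
    - inner ℝ (mlieBracket 𝓘(ℝ, E) X Z x) (Y x)
    - inner ℝ (mlieBracket 𝓘(ℝ, E) Y Z x) (X x))

variable [IsContMDiffRiemannianBundle 𝓘(ℝ, E) ∞ E (fun x : M ↦ TangentSpace 𝓘(ℝ, E) x)]

lemma mdifferentiableAt_inner {x : M} {X Y : ∀ y : M, 𝓣 y} (hX : MDiffAt (T% X) x)
    (hY : MDiffAt (T% Y) x) : MDiffAt (fun y ↦ inner ℝ (X y) (Y y)) x :=
  MDifferentiableAt.inner_bundle (F := E) (E := fun x : M ↦ 𝓣 x) (b := fun y ↦ y) hX hY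

lemma isConnectionForm_koszul : IsConnectionForm (koszul (E := E) (M := M)) where
  tensorial_left {x Y Z} hY hZ :=
    { smul := fun {f X} hf hX ↦ by
        have h1 := mdifferentiableAt_inner hX hZ
        have h2 := mdifferentiableAt_inner hX hY
        simp [koszul, mvfderiv_fun_mul hf h1, mvfderiv_fun_mul hf h2, inner_smul_left,
          inner_smul_right, inner_add_left, mlieBracket_smul_left hf hX]
        ring
      add := fun {X X'} hX hX' ↦ by
        simp [koszul, mvfderiv_fun_add (mdifferentiableAt_inner hX hZ) (mdifferentiableAt_inner hX' hZ),
          mvfderiv_fun_add (mdifferentiableAt_inner hX hY) (mdifferentiableAt_inner hX' hY),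
          inner_add_left, inner_add_right, mlieBracket_add_left hX hX']
        ring }
  tensorial_right {x X Y} hX hY :=
    { smul := fun {f Z} hf hZ ↦ by
        have h1 := mdifferentiableAt_inner hX hZ
        have h2 := mdifferentiableAt_inner hY hZ
        simp [koszul, mvfderiv_fun_mul hf h1, mvfderiv_fun_mul hf h2, inner_smul_left,
          inner_smul_right, inner_add_left, mlieBracket_smul_right hf hZ]
        rw [real_inner_comm (Z x) (X x), real_inner_comm (Z x) (Y x)]
        ring
      add := fun {Z Z'} hZ hZ' ↦ by
        simp [koszul, mvfderiv_fun_add (mdifferentiableAt_inner hX hZ) (mdifferentiableAt_inner hX hZ'),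
          mvfderiv_fun_add (mdifferentiableAt_inner hY hZ) (mdifferentiableAt_inner hY hZ'),
          inner_add_left, inner_add_right, mlieBracket_add_right hZ hZ']
        ring }
  add hX hY hY' hZ := by
    simp [koszul, mvfderiv_fun_add (mdifferentiableAt_inner hY hZ) (mdifferentiableAt_inner hY' hZ),
      mvfderiv_fun_add (mdifferentiableAt_inner hX hY) (mdifferentiableAt_inner hX hY'),
      inner_add_left, inner_add_right, mlieBracket_add_right hY hY', mlieBracket_add_left hY hY']
    ring
  leibniz {x f X Y Z} hf hX hY hZ := by
    have h1 := mdifferentiableAt_inner hX hY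
    have h2 := mdifferentiableAt_inner hY hZ
    simp [koszul, mvfderiv_fun_mul hf h1, mvfderiv_fun_mul hf h2, inner_smul_left,
      inner_smul_right, inner_add_left, mlieBracket_smul_right hf hY, mlieBracket_smul_left hf hY]
    rw [real_inner_comm (X x) (Y x)]
    ring

variable (E M) in
/-- The Levi-Civita connection `∇^g`, defined by the Koszul formula. -/
def leviCivita : CovariantDerivative 𝓘(ℝ, E) E (𝓣 : M → Type _) :=
  connectionOfForm koszul isConnectionForm_koszul

lemma leviCivita_metric {x : M} {X Y Z : ∀ y : M, 𝓣 y} (hX : MDiffAt (T% X) x)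
    (hY : MDiffAt (T% Y) x) (hZ : MDiffAt (T% Z) x) :
    d% (fun y ↦ inner ℝ (Y y) (Z y)) x (X x) =
      inner ℝ (leviCivita E M Y x (X x)) (Z x) + inner ℝ (Y x) (leviCivita E M Z x (X x)) := by
  have h1 : inner ℝ (leviCivita E M Y x (X x)) (Z x) = koszul x X Y Z :=
    inner_connectionOfForm isConnectionForm_koszul hX hY hZ
  have h2 : inner ℝ (leviCivita E M Z x (X x)) (Y x) = koszul x X Z Y :=
    inner_connectionOfForm isConnectionForm_koszul hX hZ hY
  have h3 : (fun y ↦ inner ℝ (Z y) (Y y)) = (fun y ↦ inner ℝ (Y y) (Z y)) := by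
    funext y
    exact real_inner_comm _ _
  rw [real_inner_comm] at h2
  rw [h1, h2, koszul, koszul, h3, mlieBracket_swap_apply (V := Z) (W := Y), inner_neg_left]
  ring

lemma leviCivita_torsion_free {x : M} {X Y : ∀ y : M, 𝓣 y} (hX : MDiffAt (T% X) x)
    (hY : MDiffAt (T% Y) x) :
    leviCivita E M Y x (X x) - leviCivita E M X x (Y x) = mlieBracket 𝓘(ℝ, E) X Y x := by
  refine ext_inner_right ℝ fun w ↦ ?_
  have hZ : MDiffAt (T% (extend E w)) x := mdifferentiableAt_extend ..
  have h1 : inner ℝ (leviCivita E M Y x (X x)) (extend E w x) = koszul x X Y (extend E w) :=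
    inner_connectionOfForm isConnectionForm_koszul hX hY hZ
  have h2 : inner ℝ (leviCivita E M X x (Y x)) (extend E w x) = koszul x Y X (extend E w) :=
    inner_connectionOfForm isConnectionForm_koszul hY hX hZ
  have h3 : (fun y ↦ inner ℝ (Y y) (X y)) = (fun y ↦ inner ℝ (X y) (Y y)) := by
    funext y
    exact real_inner_comm _ _
  simp only [extend_apply_self] at h1 h2
  rw [inner_sub_left, h1, h2, koszul, koszul, h3, mlieBracket_swap_apply (V := Y) (W := X),
    inner_neg_left, extend_apply_self]
  ring

/-! ### Differential forms and Hermitian structures -/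

/-- The exterior derivative of a `1`-form `θ`, evaluated at `x` on vector fields:
`dθ(X, Y) = X θ(Y) - Y θ(X) - θ([X, Y])`. -/
def extDerivOne (θ : ∀ y : M, 𝓣 y →L[ℝ] ℝ) (x : M) (X Y : ∀ y : M, 𝓣 y) : ℝ :=
  d% (fun y ↦ θ y (Y y)) x (X x) - d% (fun y ↦ θ y (X y)) x (Y x)
    - θ x (mlieBracket 𝓘(ℝ, E) X Y x)

/-- The exterior derivative of a `2`-form `α`, evaluated at `x` on vector fields:
`dα(X, Y, Z) = X α(Y, Z) - Y α(X, Z) + Z α(X, Y) - α([X, Y], Z) + α([X, Z], Y) - α([Y, Z], X)`. -/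
def extDerivTwo (α : ∀ y : M, 𝓣 y → 𝓣 y → ℝ) (x : M) (X Y Z : ∀ y : M, 𝓣 y) : ℝ :=
  d% (fun y ↦ α y (Y y) (Z y)) x (X x)
    - d% (fun y ↦ α y (X y) (Z y)) x (Y x)
    + d% (fun y ↦ α y (X y) (Y y)) x (Z x)
    - α x (mlieBracket 𝓘(ℝ, E) X Y x) (Z x)
    + α x (mlieBracket 𝓘(ℝ, E) X Z x) (Y x)
    - α x (mlieBracket 𝓘(ℝ, E) Y Z x) (X x)

variable (E M) in
/-- A complex structure `J` on `M` (a smooth almost complex structure with vanishing Nijenhuis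
tensor) for which the Riemannian metric of `M` is Hermitian. -/
structure HermitianStructure where
  /-- The complex structure on each tangent space. -/
  J : ∀ x : M, 𝓣 x →L[ℝ] 𝓣 x
  smooth : ContMDiff 𝓘(ℝ, E) (𝓘(ℝ, E).prod 𝓘(ℝ, E →L[ℝ] E)) ∞
    (fun x ↦ TotalSpace.mk' (E →L[ℝ] E) (E := fun x : M ↦ 𝓣 x →L[ℝ] 𝓣 x) x (J x))
  J_J : ∀ (x : M) (v : 𝓣 x), J x (J x v) = -v
  inner_J_J : ∀ (x : M) (v w : 𝓣 x), inner ℝ (J x v) (J x w) = inner ℝ v w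
  nijenhuis : ∀ (x : M) (X Y : ∀ y : M, 𝓣 y), ContMDiffAt 𝓘(ℝ, E) 𝓘(ℝ, E).tangent ∞ (T% X) x →
    ContMDiffAt 𝓘(ℝ, E) 𝓘(ℝ, E).tangent ∞ (T% Y) x →
    mlieBracket 𝓘(ℝ, E) (fun y ↦ J y (X y)) (fun y ↦ J y (Y y)) x
      - J x (mlieBracket 𝓘(ℝ, E) (fun y ↦ J y (X y)) Y x)
      - J x (mlieBracket 𝓘(ℝ, E) X (fun y ↦ J y (Y y)) x)
      - mlieBracket 𝓘(ℝ, E) X Y x = 0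

namespace HermitianStructure

variable (S : HermitianStructure E M)

/-- The vector field `JX`. -/
def ap (X : ∀ y : M, 𝓣 y) : ∀ y : M, 𝓣 y := fun y ↦ S.J y (X y)

/-- The fundamental `2`-form `ω(u, v) = g(Ju, v)`. -/
def fundamentalForm (x : M) (u v : 𝓣 x) : ℝ := inner ℝ (S.J x u) v

lemma fundamentalForm_antisymm (x : M) (u v : 𝓣 x) :
    S.fundamentalForm x u v = -S.fundamentalForm x v u := by
  have h := S.inner_J_J x u (S.J x v)
  rw [S.J_J, inner_neg_right] at h
  rw [fundamentalForm, fundamentalForm, real_inner_comm u, ← h, neg_neg]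

lemma mdifferentiableAt_ap {x : M} {X : ∀ y : M, 𝓣 y} (hX : MDiffAt (T% X) x) :
    MDiffAt (T% (S.ap X)) x :=
  MDifferentiableAt.clm_bundle_apply (F₁ := E) (F₂ := E) (E₁ := fun x : M ↦ 𝓣 x)
    (E₂ := fun x : M ↦ 𝓣 x) (b := fun y ↦ y) ((S.smooth x).mdifferentiableAt (by simp)) hX

/-- `dω`, evaluated at `x` on vector fields. -/
def dFundamental (x : M) (X Y Z : ∀ y : M, 𝓣 y) : ℝ := extDerivTwo S.fundamentalForm x X Y Z

lemma mdifferentiableAt_fundamentalForm {x : M} {X Y : ∀ y : M, 𝓣 y} (hX : MDiffAt (T% X) x)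
    (hY : MDiffAt (T% Y) x) : MDiffAt (fun y ↦ S.fundamentalForm y (X y) (Y y)) x :=
  mdifferentiableAt_inner (S.mdifferentiableAt_ap hX) hY

lemma dFundamental_swap_left (x : M) (X Y Z : ∀ y : M, 𝓣 y) :
    S.dFundamental x X Y Z = -S.dFundamental x Y X Z := by
  have h : (fun y ↦ S.fundamentalForm y (X y) (Y y))
      = -(fun y ↦ S.fundamentalForm y (Y y) (X y)) := by
    funext y
    exact S.fundamentalForm_antisymm _ _ _
  have hb : S.fundamentalForm x (mlieBracket 𝓘(ℝ, E) X Y x) (Z x)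
      = -S.fundamentalForm x (mlieBracket 𝓘(ℝ, E) Y X x) (Z x) := by
    rw [mlieBracket_swap_apply (V := X) (W := Y)]
    simp [fundamentalForm]
  rw [dFundamental, dFundamental, extDerivTwo, extDerivTwo, h, hb, mvfderiv_neg]
  simp
  ring

lemma dFundamental_swap_right (x : M) (X Y Z : ∀ y : M, 𝓣 y) :
    S.dFundamental x X Y Z = -S.dFundamental x X Z Y := by
  have h : (fun y ↦ S.fundamentalForm y (Y y) (Z y))
      = -(fun y ↦ S.fundamentalForm y (Z y) (Y y)) := by
    funext y
    exact S.fundamentalForm_antisymm _ _ _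
  have hb : S.fundamentalForm x (mlieBracket 𝓘(ℝ, E) Y Z x) (X x)
      = -S.fundamentalForm x (mlieBracket 𝓘(ℝ, E) Z Y x) (X x) := by
    rw [mlieBracket_swap_apply (V := Y) (W := Z)]
    simp [fundamentalForm]
  rw [dFundamental, dFundamental, extDerivTwo, extDerivTwo, h, hb, mvfderiv_neg]
  simp
  ring

lemma dFundamental_add_left {x : M} {X X' Y Z : ∀ y : M, 𝓣 y} (hX : MDiffAt (T% X) x)
    (hX' : MDiffAt (T% X') x) (hY : MDiffAt (T% Y) x) (hZ : MDiffAt (T% Z) x) :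
    S.dFundamental x (X + X') Y Z = S.dFundamental x X Y Z + S.dFundamental x X' Y Z := by
  have h {W : ∀ y : M, 𝓣 y} (hW : MDiffAt (T% W) x) :
      d% (fun y ↦ S.fundamentalForm y ((X + X') y) (W y)) x
        = d% (fun y ↦ S.fundamentalForm y (X y) (W y)) x
          + d% (fun y ↦ S.fundamentalForm y (X' y) (W y)) x := by
    rw [← mvfderiv_fun_add (S.mdifferentiableAt_fundamentalForm hX hW)
      (S.mdifferentiableAt_fundamentalForm hX' hW)]
    congr 1
    funext y
    simp [fundamentalForm, inner_add_left]
  rw [dFundamental, dFundamental, dFundamental, extDerivTwo, extDerivTwo, extDerivTwo, h hY, h hZ,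
    mlieBracket_add_left hX hX', mlieBracket_add_left hX hX']
  simp [fundamentalForm, inner_add_left, inner_add_right]
  ring

lemma dFundamental_smul_left {x : M} {f : M → ℝ} {X Y Z : ∀ y : M, 𝓣 y} (hf : MDiffAt f x)
    (hX : MDiffAt (T% X) x) (hY : MDiffAt (T% Y) x) (hZ : MDiffAt (T% Z) x) :
    S.dFundamental x (f • X) Y Z = f x * S.dFundamental x X Y Z := by
  have h {W : ∀ y : M, 𝓣 y} (hW : MDiffAt (T% W) x) (u : 𝓣 x) :
      d% (fun y ↦ S.fundamentalForm y ((f • X) y) (W y)) x u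
        = f x * d% (fun y ↦ S.fundamentalForm y (X y) (W y)) x u
          + S.fundamentalForm x (X x) (W x) * d% f x u := by
    have e : (fun y ↦ S.fundamentalForm y ((f • X) y) (W y))
        = fun y ↦ f y * S.fundamentalForm y (X y) (W y) := by
      funext y
      simp [fundamentalForm, inner_smul_left]
    rw [e, mvfderiv_fun_mul hf (S.mdifferentiableAt_fundamentalForm hX hW)]
    simp
  have hYX := S.fundamentalForm_antisymm x (Y x) (X x)
  rw [dFundamental, dFundamental, extDerivTwo, extDerivTwo, h hY, h hZ,
    mlieBracket_smul_left hf hX, mlieBracket_smul_left hf hX]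
  simp only [fundamentalForm, map_add, map_smul, map_neg, inner_add_left, inner_smul_left,
    inner_smul_right, Pi.smul_apply', conj_trivial, neg_smul, inner_neg_left, smul_eq_mul] at hYX ⊢
  ring

/-- The expression `g(∇^g_X Y, Z) + 1/2 dω(JX, JY, JZ)`. -/
def bismutForm (x : M) (X Y Z : ∀ y : M, 𝓣 y) : ℝ :=
  koszul x X Y Z + (1 / 2) * S.dFundamental x (S.ap X) (S.ap Y) (S.ap Z)

lemma ap_add (X Y : ∀ y : M, 𝓣 y) : S.ap (X + Y) = S.ap X + S.ap Y := by
  funext y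
  simp [ap]

lemma ap_smul (f : M → ℝ) (X : ∀ y : M, 𝓣 y) : S.ap (f • X) = f • S.ap X := by
  funext y
  simp [ap]

lemma isConnectionForm_bismutForm : IsConnectionForm S.bismutForm where
  tensorial_left {x Y Z} hY hZ :=
    { smul := fun {f X} hf hX ↦ by
        have h := (isConnectionForm_koszul.tensorial_left hY hZ).smul hf hX
        rw [bismutForm, h, ap_smul, S.dFundamental_smul_left hf (S.mdifferentiableAt_ap hX)
          (S.mdifferentiableAt_ap hY) (S.mdifferentiableAt_ap hZ), bismutForm]
        simp only [smul_eq_mul]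
        ring
      add := fun {X X'} hX hX' ↦ by
        have h := (isConnectionForm_koszul.tensorial_left hY hZ).add hX hX'
        rw [bismutForm, h, ap_add, S.dFundamental_add_left (S.mdifferentiableAt_ap hX)
          (S.mdifferentiableAt_ap hX') (S.mdifferentiableAt_ap hY) (S.mdifferentiableAt_ap hZ),
          bismutForm, bismutForm]
        ring }
  tensorial_right {x X Y} hX hY :=
    { smul := fun {f Z} hf hZ ↦ by
        have h := (isConnectionForm_koszul.tensorial_right hX hY).smul hf hZ
        rw [bismutForm, h, ap_smul, dFundamental_swap_right, dFundamental_swap_left,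
          S.dFundamental_smul_left hf (S.mdifferentiableAt_ap hZ)
          (S.mdifferentiableAt_ap hX) (S.mdifferentiableAt_ap hY), bismutForm,
          dFundamental_swap_right S x _ (S.ap Y), dFundamental_swap_left S x _ (S.ap Z)]
        simp only [smul_eq_mul]
        ring
      add := fun {Z Z'} hZ hZ' ↦ by
        have h := (isConnectionForm_koszul.tensorial_right hX hY).add hZ hZ'
        rw [bismutForm, h, ap_add, dFundamental_swap_right, dFundamental_swap_left,
          S.dFundamental_add_left (S.mdifferentiableAt_ap hZ) (S.mdifferentiableAt_ap hZ')
          (S.mdifferentiableAt_ap hX) (S.mdifferentiableAt_ap hY), bismutForm, bismutForm,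
          dFundamental_swap_right S x _ (S.ap Y), dFundamental_swap_left S x _ (S.ap Z),
          dFundamental_swap_right S x _ (S.ap Y) (S.ap Z'),
          dFundamental_swap_left S x _ (S.ap Z')]
        ring }
  add {x X Y Y' Z} hX hY hY' hZ := by
    have h := isConnectionForm_koszul.add hX hY hY' hZ
    rw [bismutForm, h, ap_add, dFundamental_swap_left,
      S.dFundamental_add_left (S.mdifferentiableAt_ap hY) (S.mdifferentiableAt_ap hY')
      (S.mdifferentiableAt_ap hX) (S.mdifferentiableAt_ap hZ), bismutForm, bismutForm,
      dFundamental_swap_left S x (S.ap X), dFundamental_swap_left S x (S.ap X) (S.ap Y')]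
    ring
  leibniz {x f X Y Z} hf hX hY hZ := by
    have h := isConnectionForm_koszul.leibniz hf hX hY hZ
    rw [bismutForm, h, ap_smul, dFundamental_swap_left,
      S.dFundamental_smul_left hf (S.mdifferentiableAt_ap hY)
      (S.mdifferentiableAt_ap hX) (S.mdifferentiableAt_ap hZ), bismutForm,
      dFundamental_swap_left S x (S.ap X)]
    ring

/-- The Bismut connection `∇^b`, defined by `g(∇^b_X Y, Z) = g(∇^g_X Y, Z) + 1/2 dω(JX, JY, JZ)`. -/
def bismut : CovariantDerivative 𝓘(ℝ, E) E (𝓣 : M → Type _) :=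
  connectionOfForm S.bismutForm S.isConnectionForm_bismutForm

lemma inner_bismut {x : M} {X Y Z : ∀ y : M, 𝓣 y} (hX : MDiffAt (T% X) x)
    (hY : MDiffAt (T% Y) x) (hZ : MDiffAt (T% Z) x) :
    inner ℝ (S.bismut Y x (X x)) (Z x) = inner ℝ (leviCivita E M Y x (X x)) (Z x)
      + (1 / 2) * S.dFundamental x (S.ap X) (S.ap Y) (S.ap Z) := by
  have h : inner ℝ (leviCivita E M Y x (X x)) (Z x) = koszul x X Y Z :=
    inner_connectionOfForm isConnectionForm_koszul hX hY hZ
  rw [h]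
  exact inner_connectionOfForm S.isConnectionForm_bismutForm hX hY hZ

/-! ### Vaisman structures -/

/-- `θ` is a Lee form of the locally conformally Kähler structure: a smooth closed `1`-form with
`dω = θ ∧ ω`. -/
structure IsLeeForm (θ : ∀ x : M, 𝓣 x →L[ℝ] ℝ) : Prop where
  smooth : ContMDiff 𝓘(ℝ, E) (𝓘(ℝ, E).prod 𝓘(ℝ, E →L[ℝ] ℝ)) ∞
    (fun x ↦ TotalSpace.mk' (E →L[ℝ] ℝ) (E := fun x : M ↦ 𝓣 x →L[ℝ] ℝ) x (θ x))
  closed : ∀ (x : M) (X Y : ∀ y : M, 𝓣 y), CMDiffAt ∞ (T% X) x → CMDiffAt ∞ (T% Y) x →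
    extDerivOne θ x X Y = 0
  d_fundamental : ∀ (x : M) (X Y Z : ∀ y : M, 𝓣 y), CMDiffAt ∞ (T% X) x →
    CMDiffAt ∞ (T% Y) x → CMDiffAt ∞ (T% Z) x →
    S.dFundamental x X Y Z = θ x (X x) * S.fundamentalForm x (Y x) (Z x)
      + θ x (Y x) * S.fundamentalForm x (Z x) (X x)
      + θ x (Z x) * S.fundamentalForm x (X x) (Y x)

/-- The Hermitian structure is Vaisman with Lee form `θ`: it is locally conformally Kähler and
`∇^g θ = 0`. -/
structure IsVaisman (θ : ∀ x : M, 𝓣 x →L[ℝ] ℝ) : Prop where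
  isLeeForm : S.IsLeeForm θ
  parallel : ∀ (x : M) (u : 𝓣 x) (Y : ∀ y : M, 𝓣 y), CMDiffAt ∞ (T% Y) x →
    d% (fun y ↦ θ y (Y y)) x u - θ x (leviCivita E M Y x u) = 0

/-- An identification of the Hermitian vector space `(T_p M, J_p, g_p)` with a standard complex
Euclidean space: `J_p` becomes multiplication by `i`, and `g_p` becomes the real part of the
standard Hermitian inner product. -/
structure IsUnitaryFrame {ι : Type*} [Fintype ι] (p : M)
    (φ : 𝓣 p ≃ₗ[ℝ] EuclideanSpace ℂ ι) : Prop where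
  map_J : ∀ v : 𝓣 p, φ (S.J p v) = Complex.I • φ v
  re_inner : ∀ v w : 𝓣 p, (inner ℂ (φ v) (φ w)).re = inner ℝ v w

end HermitianStructure

end Metric

/-! ### Parallel transport and holonomy -/

section Holonomy

variable [IsManifold 𝓘(ℝ, E) ∞ M]

/-- The covariant derivative `D_t V` at time `t` of a vector field `V` along a curve `γ`. In the
coordinate frame `(∂_i)` of the chart at `γ t`, with `V = ∑ V^i ∂_i`, it is
`∑ (V^i)' ∂_i + ∑ V^i ∇_{γ'} ∂_i`. -/
def covDerivAlong (cov : CovariantDerivative 𝓘(ℝ, E) E (𝓣 : M → Type _)) (γ : ℝ → M)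
    (V : ∀ s, 𝓣 (γ s)) (t : ℝ) : 𝓣 (γ t) :=
  (trivializationAt E (𝓣 : M → Type _) (γ t)).symm (γ t)
      (deriv (fun s ↦ (trivializationAt E (𝓣 : M → Type _) (γ t) ⟨γ s, V s⟩).2) t)
    + cov (extend E (V t)) (γ t) (mfderiv 𝓘(ℝ, ℝ) 𝓘(ℝ, E) γ t (1 : ℝ))

/-- `V` is a vector field along `γ`, differentiable at time `t`, with `D_t V = 0` there. -/
def IsParallelAt (cov : CovariantDerivative 𝓘(ℝ, E) E (𝓣 : M → Type _)) (γ : ℝ → M)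
    (V : ∀ s, 𝓣 (γ s)) (t : ℝ) : Prop :=
  MDifferentiableAt 𝓘(ℝ, ℝ) 𝓘(ℝ, E).tangent
      (fun s ↦ (⟨γ s, V s⟩ : TangentBundle 𝓘(ℝ, E) M)) t
    ∧ covDerivAlong cov γ V t = 0

/-- `V` is parallel along the piecewise smooth curve `γ : [0, 1] → M`: it is continuous, and
`D_t V = 0` at all but finitely many times. -/
def IsParallelAlong (cov : CovariantDerivative 𝓘(ℝ, E) E (𝓣 : M → Type _)) (γ : ℝ → M)
    (V : ∀ s, 𝓣 (γ s)) : Prop :=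
  ContinuousOn (fun s ↦ (⟨γ s, V s⟩ : TangentBundle 𝓘(ℝ, E) M)) (Icc 0 1)
    ∧ {t ∈ Ioo (0 : ℝ) 1 | ¬ IsParallelAt cov γ V t}.Finite

/-- The restriction of `γ` to `[0, 1]` is a piecewise smooth loop based at `p`: for some subdivision
`0 = τ 0 < τ 1 < ⋯ < τ k = 1`, `γ` is smooth on each `[τ i, τ (i + 1)]`. -/
def IsPiecewiseSmoothLoop (p : M) (γ : ℝ → M) : Prop :=
  γ 0 = p ∧ γ 1 = p ∧ ∃ (k : ℕ) (τ : Fin (k + 1) → ℝ), StrictMono τ ∧ τ 0 = 0 ∧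
    τ (Fin.last k) = 1 ∧
    ∀ i : Fin k, ContMDiffOn 𝓘(ℝ, ℝ) 𝓘(ℝ, E) ∞ γ (Icc (τ i.castSucc) (τ i.succ))

/-- `P` is the parallel transport map along `γ : [0, 1] → M`, from `γ 0 = x` to `γ 1 = y`: each
`v ∈ T_x M` extends to a parallel vector field along `γ` which ends in `P v`. -/
def IsParallelTransport (cov : CovariantDerivative 𝓘(ℝ, E) E (𝓣 : M → Type _)) (γ : ℝ → M)
    {x y : M} (P : 𝓣 x ≃L[ℝ] 𝓣 y) : Prop :=
  ∀ v : 𝓣 x, ∃ V : ∀ s, 𝓣 (γ s), IsParallelAlong cov γ V ∧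
    (⟨γ 0, V 0⟩ : TangentBundle 𝓘(ℝ, E) M) = ⟨x, v⟩ ∧
    (⟨γ 1, V 1⟩ : TangentBundle 𝓘(ℝ, E) M) = ⟨y, P v⟩

/-- The holonomy group of a connection at `p`: the parallel transport maps `P_γ ∈ GL(T_p M)` along
the piecewise smooth loops `γ` based at `p`. -/
def holonomy (cov : CovariantDerivative 𝓘(ℝ, E) E (𝓣 : M → Type _)) (p : M) :
    Set (𝓣 p ≃L[ℝ] 𝓣 p) :=
  {P | ∃ γ : ℝ → M, IsPiecewiseSmoothLoop (E := E) p γ ∧ IsParallelTransport cov γ P}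

end Holonomy

/-- The embedding `B ↦ diag(1, B)` of `U(m)` in the matrices of size `1 + m`. -/
def diagOne {m : ℕ} (B : Matrix.unitaryGroup (Fin m) ℂ) :
    Matrix (Unit ⊕ Fin m) (Unit ⊕ Fin m) ℂ :=
  Matrix.fromBlocks 1 0 0 (B : Matrix (Fin m) (Fin m) ℂ)

lemma diagOne_mem_unitaryGroup {m : ℕ} (B : Matrix.unitaryGroup (Fin m) ℂ) :
    diagOne B ∈ Matrix.unitaryGroup (Unit ⊕ Fin m) ℂ := by
  have h := Matrix.mem_unitaryGroup_iff.1 B.2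
  rw [Matrix.mem_unitaryGroup_iff, diagOne, Matrix.star_eq_conjTranspose,
    Matrix.fromBlocks_conjTranspose, Matrix.fromBlocks_multiply]
  rw [Matrix.star_eq_conjTranspose] at h
  simp [h, Matrix.fromBlocks_one]

end BismutVaisman

end

open BismutVaisman

/-!
The idea is that the Bismut connection `∇^b` is Hermitian and that the Lee field `A` is parallel
for it, so that its parallel transport around a loop is unitary and fixes `A`.

* `∇^b` is metric because the `3`-form `dω(J·, J·, J·)` is skew (`IsLeeForm.bismut_metric`). It
  preserves `J` because of integrability: `dω` is the cyclic sum of `∇^g J`, and together with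
  `N_J = 0` this gives `2 g((∇^g_X J) Y, Z) = dω(X, Y, Z) - dω(X, JY, JZ)` (`two_mul_covJ`), which
  is the defect that the torsion term corrects (`IsLeeForm.bismut_ap`).
* From `∇^g θ = 0` one has `∇^g A = 0`, and with `dω = θ ∧ ω` the form `dω(J·, J·, J·)` becomes
  `Jθ ∧ ω` up to the sign of `Jθ`, whose contraction with `A` is zero. Thus `∇^b A = 0`
  (`IsVaisman.bismut_leeField`), and `∇^b (JA) = J ∇^b A = 0`. The length of `A` is constant on the
  connected manifold `M`, so `A` vanishes nowhere (`IsVaisman.leeField_ne_zero`).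
* Scalar products of parallel fields along a curve are constant. For a piecewise smooth curve the
  derivative is available off a finite set only, and continuity bridges the gaps. Applied to `V` and
  `W`, to `JV` and `W`, and to `A` and `W`, where `V` and `W` are parallel along a loop, this shows
  that the parallel transport preserves `g` and `ω`, hence commutes with `J`, and fixes `A`.
  The derivative is computed by the Leibniz rule from an expansion of `V` in vector fields of `M`
  along the curve (`HasParallelExpansion`), which avoids uniqueness of parallel fields and any
  composition of tensor fields with the curve.
* A unitary frame at `p` whose first vector is `A / |A|` exists by extending an orthonormal family
  to a basis (`exists_unitary_equiv_of_unit`), and in it a unitary map which fixes `A` has the form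
  `diag(1, B)` (`exists_eq_diagOne`).
-/

set_option linter.unusedSectionVars false

namespace BismutVaisman

section

variable {E : Type*} [NormedAddCommGroup E] [NormedSpace ℝ E] [FiniteDimensional ℝ E]
  {M : Type*} [TopologicalSpace M] [ChartedSpace E M] [IsManifold 𝓘(ℝ, E) ∞ M]
  [RiemannianBundle (fun x : M ↦ TangentSpace 𝓘(ℝ, E) x)]
  [IsContMDiffRiemannianBundle 𝓘(ℝ, E) ∞ E (fun x : M ↦ TangentSpace 𝓘(ℝ, E) x)]

local notation "𝓣" => TangentSpace 𝓘(ℝ, E)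

/-! ### The Bismut connection preserves the Hermitian structure -/

namespace HermitianStructure

variable (S : HermitianStructure E M) {x : M}

lemma contMDiffAt_ap {X : ∀ y : M, 𝓣 y} (hX : CMDiffAt ∞ (T% X) x) : CMDiffAt ∞ (T% (S.ap X)) x :=
  ContMDiffAt.clm_bundle_apply (F₁ := E) (F₂ := E) (E₁ := fun x : M ↦ 𝓣 x)
    (E₂ := fun x : M ↦ 𝓣 x) (b := fun y ↦ y) (S.smooth x) hX

lemma inner_J_left (v w : 𝓣 x) : inner ℝ (S.J x v) w = -inner ℝ v (S.J x w) := by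
  rw [← S.inner_J_J x v, S.J_J, inner_neg_right, neg_neg]

/-- `g((∇^g_X J) Y, Z)`, evaluated at `x` on vector fields. -/
noncomputable def covJ (x : M) (X Y Z : ∀ y : M, 𝓣 y) : ℝ :=
  inner ℝ (leviCivita E M (S.ap Y) x (X x)) (Z x)
    - inner ℝ (S.J x (leviCivita E M Y x (X x))) (Z x)

/-- The derivative of `ω(Y, Z)` splits into `g((∇^g_X J) Y, Z)` and two terms in which `Y` and `Z`
are differentiated, as `∇^g` is metric. -/
lemma covJ_eq {X Y Z : ∀ y : M, 𝓣 y}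
    (hX : MDiffAt (T% X) x) (hY : MDiffAt (T% Y) x) (hZ : MDiffAt (T% Z) x) :
    d% (fun y ↦ S.fundamentalForm y (Y y) (Z y)) x (X x) = S.covJ x X Y Z
      + S.fundamentalForm x (leviCivita E M Y x (X x)) (Z x)
      + S.fundamentalForm x (Y x) (leviCivita E M Z x (X x)) := by
  have h := leviCivita_metric hX (S.mdifferentiableAt_ap hY) hZ
  simp only [ap] at h
  simp only [fundamentalForm, covJ, h]
  ring

lemma covJ_swap {X Y Z : ∀ y : M, 𝓣 y}
    (hX : MDiffAt (T% X) x) (hY : MDiffAt (T% Y) x) (hZ : MDiffAt (T% Z) x) :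
    S.covJ x X Y Z = -S.covJ x X Z Y := by
  have h : (fun y ↦ S.fundamentalForm y (Y y) (Z y))
      = -(fun y ↦ S.fundamentalForm y (Z y) (Y y)) := by
    funext y
    exact S.fundamentalForm_antisymm _ _ _
  have h1 := S.covJ_eq hX hY hZ
  have h2 := S.covJ_eq hX hZ hY
  rw [h, mvfderiv_neg] at h1
  simp only [neg_apply] at h1
  rw [h2, S.fundamentalForm_antisymm x _ (Y x), S.fundamentalForm_antisymm x (Z x)] at h1
  linarith

lemma ap_ap (X : ∀ y : M, 𝓣 y) : S.ap (S.ap X) = (-1 : ℝ) • X := by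
  funext y
  simp [ap, S.J_J]

/-- `∇^g_X J` anticommutes with `J`. -/
lemma covJ_ap_ap {X Y Z : ∀ y : M, 𝓣 y}
    (hY : MDiffAt (T% Y) x) : S.covJ x X (S.ap Y) (S.ap Z) = -S.covJ x X Y Z := by
  have h := (leviCivita E M).isCovariantDerivativeOnUniv.smul_const (-1 : ℝ) hY
  simp only [covJ, ap_ap, h]
  simp only [ap, S.inner_J_J]
  simp [S.inner_J_left]
  ring

/-- `dω` is the cyclic sum of `∇^g J`, as the Levi-Civita connection has no torsion. -/
lemma dFundamental_eq_covJ {X Y Z : ∀ y : M, 𝓣 y}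
    (hX : MDiffAt (T% X) x) (hY : MDiffAt (T% Y) x)
    (hZ : MDiffAt (T% Z) x) :
    S.dFundamental x X Y Z = S.covJ x X Y Z + S.covJ x Y Z X + S.covJ x Z X Y := by
  have hs := S.covJ_swap hY hZ hX
  rw [dFundamental, extDerivTwo, S.covJ_eq hX hY hZ, S.covJ_eq hY hX hZ, S.covJ_eq hZ hX hY,
    ← leviCivita_torsion_free hX hY, ← leviCivita_torsion_free hX hZ,
    ← leviCivita_torsion_free hY hZ, S.fundamentalForm_antisymm x (Y x),
    S.fundamentalForm_antisymm x (X x), S.fundamentalForm_antisymm x (X x), hs]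
  simp only [fundamentalForm, map_sub, inner_sub_left]
  ring

/-- The vanishing of the Nijenhuis tensor, expressed through `∇^g J`. -/
lemma covJ_nijenhuis {X Y Z : ∀ y : M, 𝓣 y}
    (hX : CMDiffAt ∞ (T% X) x) (hY : CMDiffAt ∞ (T% Y) x) :
    S.covJ x (S.ap X) Y Z - S.covJ x (S.ap Y) X Z - S.covJ x Y X (S.ap Z)
      + S.covJ x X Y (S.ap Z) = 0 := by
  have hX' : MDiffAt (T% X) x := hX.mdifferentiableAt (by simp)
  have hY' : MDiffAt (T% Y) x := hY.mdifferentiableAt (by simp)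
  have h := S.nijenhuis x X Y hX hY
  change mlieBracket 𝓘(ℝ, E) (S.ap X) (S.ap Y) x - S.J x (mlieBracket 𝓘(ℝ, E) (S.ap X) Y x)
    - S.J x (mlieBracket 𝓘(ℝ, E) X (S.ap Y) x) - mlieBracket 𝓘(ℝ, E) X Y x = 0 at h
  rw [← leviCivita_torsion_free hX' hY',
    ← leviCivita_torsion_free (S.mdifferentiableAt_ap hX') hY',
    ← leviCivita_torsion_free hX' (S.mdifferentiableAt_ap hY'),
    ← leviCivita_torsion_free (S.mdifferentiableAt_ap hX') (S.mdifferentiableAt_ap hY')] at h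
  have h' := congrArg (fun v ↦ inner ℝ v (Z x)) h
  simp only [inner_sub_left, map_sub, inner_zero_left] at h'
  simp only [covJ]
  simp only [ap, S.inner_J_J] at h' ⊢
  simp only [S.inner_J_left _ (Z x)] at h' ⊢
  linarith

/-- On a Hermitian manifold `∇^g J` is determined by `dω`. This is where the integrability of `J`
is used. -/
lemma two_mul_covJ {X Y Z : ∀ y : M, 𝓣 y}
    (hX : CMDiffAt ∞ (T% X) x) (hY : CMDiffAt ∞ (T% Y) x)
    (hZ : CMDiffAt ∞ (T% Z) x) :
    2 * S.covJ x X Y Z = S.dFundamental x X Y Z - S.dFundamental x X (S.ap Y) (S.ap Z) := by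
  have hX' : MDiffAt (T% X) x := hX.mdifferentiableAt (by simp)
  have hY' : MDiffAt (T% Y) x := hY.mdifferentiableAt (by simp)
  have hZ' : MDiffAt (T% Z) x := hZ.mdifferentiableAt (by simp)
  have hJY := S.mdifferentiableAt_ap hY'
  have hJZ := S.mdifferentiableAt_ap hZ'
  -- the Nijenhuis identity at `(Y, JZ)`, tested against `X`, brings the six terms of
  -- `dω(X, Y, Z) - dω(X, JY, JZ)` down to two
  have hN := S.covJ_nijenhuis (Z := X) hY (S.contMDiffAt_ap hZ)
  have e1 : S.covJ x (S.ap (S.ap Z)) Y X = -S.covJ x Z Y X := by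
    simp [covJ, ap_ap]
    ring
  have e2 : S.covJ x Y (S.ap Z) (S.ap X) = -S.covJ x Y Z X := S.covJ_ap_ap hZ'
  -- `J` may be moved between the two slots of the skew form `g((∇^g_{JZ} J)·, ·)`
  have e3 : S.covJ x (S.ap Z) X (S.ap Y) = -S.covJ x (S.ap Z) Y (S.ap X) := by
    rw [S.covJ_swap hJZ hX' hJY]
    have h := S.covJ_ap_ap (X := S.ap Z) (Z := S.ap X) hY'
    simp only [ap_ap] at h
    simp only [covJ, Pi.smul_apply, inner_smul_right] at h ⊢
    linarith
  have e4 := S.covJ_swap hZ' hX' hY'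
  rw [S.dFundamental_eq_covJ hX' hY' hZ', S.dFundamental_eq_covJ hX' hJY hJZ,
    S.covJ_ap_ap hY']
  linarith

variable {S}

/-- On a locally conformally Kähler manifold, the defining formula of the Bismut connection, with
`dω` replaced by `θ ∧ ω`. -/
lemma IsLeeForm.inner_bismut {X Y Z : ∀ y : M, 𝓣 y}
    {θ : ∀ x : M, 𝓣 x →L[ℝ] ℝ} (hθ : S.IsLeeForm θ)
    (hX : CMDiffAt ∞ (T% X) x)
    (hY : CMDiffAt ∞ (T% Y) x) (hZ : CMDiffAt ∞ (T% Z) x) :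
    inner ℝ (S.bismut Y x (X x)) (Z x) = inner ℝ (leviCivita E M Y x (X x)) (Z x)
      + (1 / 2) * (θ x (S.J x (X x)) * S.fundamentalForm x (Y x) (Z x)
        + θ x (S.J x (Y x)) * S.fundamentalForm x (Z x) (X x)
        + θ x (S.J x (Z x)) * S.fundamentalForm x (X x) (Y x)) := by
  rw [S.inner_bismut (hX.mdifferentiableAt (by simp)) (hY.mdifferentiableAt (by simp))
    (hZ.mdifferentiableAt (by simp)), hθ.d_fundamental x _ _ _ (S.contMDiffAt_ap hX)
    (S.contMDiffAt_ap hY) (S.contMDiffAt_ap hZ)]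
  simp only [fundamentalForm, ap, S.inner_J_J]

/-- The Bismut connection is metric, as its torsion is totally skew-symmetric. -/
lemma IsLeeForm.bismut_metric {Y Z : ∀ y : M, 𝓣 y}
    {θ : ∀ x : M, 𝓣 x →L[ℝ] ℝ} (hθ : S.IsLeeForm θ)
    (u : 𝓣 x)
    (hY : CMDiffAt ∞ (T% Y) x) (hZ : CMDiffAt ∞ (T% Z) x) :
    d% (fun y ↦ inner ℝ (Y y) (Z y)) x u =
      inner ℝ (S.bismut Y x u) (Z x) + inner ℝ (Y x) (S.bismut Z x u) := by
  have hX : CMDiffAt ∞ (T% (extend E u)) x := contMDiffAt_extend ..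
  have h := leviCivita_metric (hX.mdifferentiableAt (by simp)) (hY.mdifferentiableAt (by simp))
    (hZ.mdifferentiableAt (by simp))
  have h1 := hθ.inner_bismut hX hY hZ
  have h2 := hθ.inner_bismut hX hZ hY
  rw [extend_apply_self] at h h1 h2
  rw [real_inner_comm] at h2
  rw [h, h1, h2, real_inner_comm (Y x), S.fundamentalForm_antisymm x (Z x) (Y x),
    S.fundamentalForm_antisymm x (Y x) u, S.fundamentalForm_antisymm x u (Z x)]
  ring

/-- The Bismut connection preserves the complex structure: `two_mul_covJ` says that the torsion term
makes up for the failure of `∇^g` to do so. -/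
lemma IsLeeForm.bismut_ap {Y : ∀ y : M, 𝓣 y} {θ : ∀ x : M, 𝓣 x →L[ℝ] ℝ} (hθ : S.IsLeeForm θ)
    (u : 𝓣 x) (hY : CMDiffAt ∞ (T% Y) x) :
    S.bismut (S.ap Y) x u = S.J x (S.bismut Y x u) := by
  refine ext_inner_right ℝ fun w ↦ ?_
  have hX : CMDiffAt ∞ (T% (extend E u)) x := contMDiffAt_extend ..
  have hZ : CMDiffAt ∞ (T% (extend E w)) x := contMDiffAt_extend ..
  have h1 := hθ.inner_bismut hX (S.contMDiffAt_ap hY) hZ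
  have h2 := hθ.inner_bismut hX hY (S.contMDiffAt_ap hZ)
  have h3 := S.two_mul_covJ hX hY hZ
  rw [hθ.d_fundamental x _ _ _ hX hY hZ, hθ.d_fundamental x _ _ _ hX (S.contMDiffAt_ap hY)
    (S.contMDiffAt_ap hZ)] at h3
  simp only [covJ, ap, fundamentalForm, extend_apply_self, S.inner_J_J, S.J_J, inner_neg_left,
    map_neg] at h1 h2 h3
  rw [S.inner_J_left _ w]
  rw [S.inner_J_left _ w] at h3
  rw [h1, h2]
  linear_combination (1 / 2) * h3 + (1 / 2) * θ x u * S.inner_J_left (Y x) w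

end HermitianStructure

/-! ### Smoothness of the musical isomorphism -/

/-- The musical isomorphism is smooth. In a trivialization the metric becomes a smooth map into
`E →L[ℝ] E →L[ℝ] ℝ` with invertible values, and inversion of continuous linear maps is smooth. -/
lemma contMDiffAt_sharp {x : M} {α : ∀ y : M, 𝓣 y →L[ℝ] ℝ}
    (hα : ContMDiffAt 𝓘(ℝ, E) (𝓘(ℝ, E).prod 𝓘(ℝ, E →L[ℝ] ℝ)) ∞
      (fun y ↦ TotalSpace.mk' (E →L[ℝ] ℝ) (E := fun y : M ↦ 𝓣 y →L[ℝ] ℝ) y (α y)) x) :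
    CMDiffAt ∞ (T% (fun y ↦ sharp y (α y))) x := by
  obtain ⟨g, hg, hinner⟩ := IsContMDiffRiemannianBundle.exists_contMDiff (IB := 𝓘(ℝ, E)) (n := ∞)
    (F := E) (E := fun x : M ↦ 𝓣 x)
  have hgx := (contMDiffAt_section x).1 (hg x)
  have hαx := (contMDiffAt_section x).1 hα
  rw [contMDiffAt_section]
  set t := trivializationAt E (𝓣 : M → Type _) x
  have hb : ∀ᶠ y in 𝓝 x, y ∈ t.baseSet :=
    t.open_baseSet.mem_nhds (FiberBundle.mem_baseSet_trivializationAt' x)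
  set G : M → E →L[ℝ] E →L[ℝ] ℝ := fun y ↦
    (trivializationAt (E →L[ℝ] E →L[ℝ] ℝ) (fun y : M ↦ 𝓣 y →L[ℝ] 𝓣 y →L[ℝ] ℝ) x ⟨y, g y⟩).2
  set a : M → E →L[ℝ] ℝ := fun y ↦
    (trivializationAt (E →L[ℝ] ℝ) (fun y : M ↦ 𝓣 y →L[ℝ] ℝ) x ⟨y, α y⟩).2
  have hG {y : M} (hy : y ∈ t.baseSet) (v w : E) :
      G y v w = inner ℝ (t.symm y v) (t.symm y w) := by
    rw [hinner]
    simp only [G, hom_trivializationAt_apply]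
    rw [inCoordinates_apply_eq₂ hy hy (mem_univ _)]
    simp [t]
  have ha {y : M} (hy : y ∈ t.baseSet) (w : E) : a y w = α y (t.symm y w) := by
    simp only [a, hom_trivializationAt_apply]
    rw [ContinuousLinearMap.inCoordinates_eq hy (mem_univ _)]
    simp [t]
  have hinv {y : M} (hy : y ∈ t.baseSet) : (G y).IsInvertible := by
    have hinj : Function.Injective (G y) := by
      rw [injective_iff_map_eq_zero]
      intro v hv
      have h0 : inner ℝ (t.symm y v) (t.symm y v) = 0 := by rw [← hG hy, hv]; rfl
      have h1 := inner_self_eq_zero.1 h0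
      rw [← t.symmL_apply (R := ℝ) hy] at h1
      rw [← t.continuousLinearMapAt_symmL (R := ℝ) hy v, h1, map_zero]
    have hdim : Module.finrank ℝ E = Module.finrank ℝ (E →L[ℝ] ℝ) := by
      rw [← (LinearMap.toContinuousLinearMap (𝕜 := ℝ) (E := E) (F' := ℝ)).finrank_eq]
      exact (Subspace.dual_finrank_eq (K := ℝ) (V := E)).symm
    exact ⟨(LinearEquiv.ofInjectiveOfFinrankEq (G y).toLinearMap hinj hdim).toContinuousLinearEquiv,
      by ext; rfl⟩
  have key {y : M} (hy : y ∈ t.baseSet) :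
      (t ⟨y, sharp y (α y)⟩).2 = (G y).inverse (a y) := by
    rw [eq_comm, ContinuousLinearMap.IsInvertible.inverse_apply_eq (hinv hy)]
    ext w
    rw [hG hy, ha hy, ← inner_sharp, t.symm_apply_apply_mk hy]
  have hx : x ∈ t.baseSet := FiberBundle.mem_baseSet_trivializationAt' x
  have h1 : ContMDiffAt 𝓘(ℝ, E) 𝓘(ℝ, (E →L[ℝ] ℝ) →L[ℝ] E) ∞ (fun y ↦ (G y).inverse) x :=
    ContDiffAt.comp_contMDiffAt (hinv hx).contDiffAt_map_inverse hgx
  have h2 := h1.clm_apply hαx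
  refine h2.congr_of_eventuallyEq ?_
  filter_upwards [hb] with y hy using key hy

/-! ### The Lee field is parallel -/

lemma eq_of_mvfderiv_eq_zero [ConnectedSpace M] {f : M → ℝ} (hf : MDiff f)
    (h : ∀ x, d% f x = 0) (x y : M) : f x = f y := by
  have hloc : IsLocallyConstant f := by
    rw [IsLocallyConstant.iff_eventually_eq]
    intro x
    set φ := extChartAt 𝓘(ℝ, E) x
    have hopen : IsOpen φ.target := isOpen_extChartAt_target x
    obtain ⟨r, hr, hball⟩ := Metric.isOpen_iff.1 hopen (φ x) (mem_extChartAt_target x)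
    have hd {z : E} (hz : z ∈ φ.target) : HasFDerivAt (f ∘ φ.symm) (0 : E →L[ℝ] ℝ) z := by
      have h1 : HasMFDerivAt 𝓘(ℝ, E) 𝓘(ℝ, ℝ) f (φ.symm z) 0 := by
        have h2 := (hf (φ.symm z)).hasMFDerivAt
        have h3 : mfderiv 𝓘(ℝ, E) 𝓘(ℝ, ℝ) f (φ.symm z) = 0 := h (φ.symm z)
        rwa [h3] at h2
      have h4 : MDifferentiableAt 𝓘(ℝ, E) 𝓘(ℝ, E) φ.symm z :=
        ((contMDiffOn_extChartAt_symm (n := ∞) x).contMDiffAt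
          (hopen.mem_nhds hz)).mdifferentiableAt (by simp)
      have h5 := h1.comp z h4.hasMFDerivAt
      rw [ContinuousLinearMap.zero_comp] at h5
      exact h5.hasFDerivAt
    filter_upwards [extChartAt_source_mem_nhds (I := 𝓘(ℝ, E)) x,
      (continuousAt_extChartAt (I := 𝓘(ℝ, E)) x).preimage_mem_nhds (Metric.ball_mem_nhds _ hr)]
      with y hy hyr
    have := (convex_ball (φ x) r).is_const_of_fderivWithin_eq_zero (𝕜 := ℝ) (f := f ∘ φ.symm)
      (fun z hz ↦ (hd (hball hz)).differentiableAt.differentiableWithinAt)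
      (fun z hz ↦ by
        rw [fderivWithin_of_isOpen Metric.isOpen_ball hz, (hd (hball hz)).fderiv])
      hyr (Metric.mem_ball_self hr)
    rwa [Function.comp_apply, Function.comp_apply, φ.left_inv hy,
      φ.left_inv (mem_extChartAt_source x)] at this
  exact hloc.apply_eq_of_preconnectedSpace x y

namespace HermitianStructure.IsVaisman

variable {S : HermitianStructure E M}

lemma contMDiffAt_leeField {θ : ∀ x : M, 𝓣 x →L[ℝ] ℝ} (hθ : S.IsVaisman θ) (x : M) :
    CMDiffAt ∞ (T% (fun y ↦ sharp y (θ y))) x :=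
  contMDiffAt_sharp (hθ.isLeeForm.smooth x)

/-- A vector field is parallel when its dual `1`-form is, as the Levi-Civita connection is metric. -/
lemma leviCivita_leeField {θ : ∀ x : M, 𝓣 x →L[ℝ] ℝ} (hθ : S.IsVaisman θ) (x : M) (u : 𝓣 x) :
    leviCivita E M (fun y ↦ sharp y (θ y)) x u = 0 := by
  refine ext_inner_right ℝ fun w ↦ ?_
  have hX : CMDiffAt ∞ (T% (extend E u)) x := contMDiffAt_extend ..
  have hZ : CMDiffAt ∞ (T% (extend E w)) x := contMDiffAt_extend ..
  have h := leviCivita_metric (hX.mdifferentiableAt (by simp))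
    ((hθ.contMDiffAt_leeField x).mdifferentiableAt (by simp)) (hZ.mdifferentiableAt (by simp))
  have hp := hθ.parallel x u _ hZ
  simp only [inner_sharp, extend_apply_self] at h
  rw [inner_zero_left]
  linarith

/-- The Lee field is Bismut-parallel: it is Levi-Civita parallel, and it lies in the kernel of the
torsion form `dω(J·, J·, J·)`. -/
lemma bismut_leeField {θ : ∀ x : M, 𝓣 x →L[ℝ] ℝ} (hθ : S.IsVaisman θ) (x : M) (u : 𝓣 x) :
    S.bismut (fun y ↦ sharp y (θ y)) x u = 0 := by
  refine ext_inner_right ℝ fun w ↦ ?_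
  have hX : CMDiffAt ∞ (T% (extend E u)) x := contMDiffAt_extend ..
  have hZ : CMDiffAt ∞ (T% (extend E w)) x := contMDiffAt_extend ..
  have h := hθ.isLeeForm.inner_bismut hX (hθ.contMDiffAt_leeField x) hZ
  -- `A` is orthogonal to `JA`
  have hJA : θ x (S.J x (sharp x (θ x))) = 0 := by
    have h1 := S.inner_J_left (sharp x (θ x)) (sharp x (θ x))
    rw [real_inner_comm, inner_sharp] at h1
    linarith
  simp only [fundamentalForm, extend_apply_self, hθ.leviCivita_leeField, hJA] at h
  rw [h, S.inner_J_left _ w, inner_sharp, real_inner_comm (sharp x (θ x)), inner_sharp]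
  simp
  ring

lemma bismut_J_leeField {θ : ∀ x : M, 𝓣 x →L[ℝ] ℝ} (hθ : S.IsVaisman θ) (x : M) (u : 𝓣 x) :
    S.bismut (fun y ↦ S.J y (sharp y (θ y))) x u = 0 := by
  have h := hθ.isLeeForm.bismut_ap u (hθ.contMDiffAt_leeField x)
  rw [hθ.bismut_leeField, map_zero] at h
  exact h

/-- The Lee field has constant length, so that it vanishes nowhere if it is not identically zero. -/
lemma leeField_ne_zero [ConnectedSpace M] {θ : ∀ x : M, 𝓣 x →L[ℝ] ℝ} (hθ : S.IsVaisman θ)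
    (hne : ∃ x, θ x ≠ 0) (p : M) : sharp p (θ p) ≠ 0 := by
  obtain ⟨q, hq⟩ := hne
  have hA (x : M) : MDiffAt (T% (fun y ↦ sharp y (θ y))) x :=
    (hθ.contMDiffAt_leeField x).mdifferentiableAt (by simp)
  have hc := eq_of_mvfderiv_eq_zero
    (f := fun y ↦ inner ℝ (sharp y (θ y)) (sharp y (θ y)))
    (fun x ↦ mdifferentiableAt_inner (hA x) (hA x)) (fun x ↦ by
      ext u
      have hX : MDiffAt (T% (extend E u)) x := mdifferentiableAt_extend ..
      have h := leviCivita_metric hX (hA x) (hA x)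
      rw [hθ.leviCivita_leeField, inner_zero_left, inner_zero_right, extend_apply_self] at h
      simpa using h) p q
  intro h0
  simp only [h0, inner_zero_left] at hc
  have hq0 := inner_self_eq_zero.1 hc.symm
  refine hq (ContinuousLinearMap.ext fun w ↦ ?_)
  rw [← inner_sharp, hq0, inner_zero_left]
  rfl

end HermitianStructure.IsVaisman

/-! ### Parallel vector fields along a curve -/

/-- `V` is, near time `t`, a vector field of `M` restricted to `γ`, plus a combination of such
fields with coefficients that vanish at time `t`; and `D_t V = 0`, computed by the Leibniz rule from
this expansion. Unlike `IsParallelAt`, which fixes the fields by a trivialization, this notion is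
stable under tensors that the connection preserves. -/
def HasParallelExpansion (cov : CovariantDerivative 𝓘(ℝ, E) E (𝓣 : M → Type _)) (γ : ℝ → M)
    (V : ∀ s, 𝓣 (γ s)) (t : ℝ) : Prop :=
  ∃ (X₀ : ∀ y : M, 𝓣 y) (k : ℕ) (v : Fin k → ℝ → ℝ) (v' : Fin k → ℝ)
    (X : Fin k → ∀ y : M, 𝓣 y),
    ContMDiffAt 𝓘(ℝ, E) 𝓘(ℝ, E).tangent ∞ (fun y ↦ (⟨y, X₀ y⟩ : TangentBundle 𝓘(ℝ, E) M)) (γ t) ∧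
    (∀ i, ContMDiffAt 𝓘(ℝ, E) 𝓘(ℝ, E).tangent ∞
      (fun y ↦ (⟨y, X i y⟩ : TangentBundle 𝓘(ℝ, E) M)) (γ t)) ∧
    (∀ i, v i t = 0) ∧ (∀ i, HasDerivAt (v i) (v' i) t) ∧
    (∀ᶠ s in 𝓝 t, V s = X₀ (γ s) + ∑ i, v i s • X i (γ s)) ∧
    cov X₀ (γ t) (mfderiv 𝓘(ℝ, ℝ) 𝓘(ℝ, E) γ t (1 : ℝ)) + ∑ i, v' i • X i (γ t) = 0

/-- The differentiability of `V` as a curve in the tangent bundle, which `IsParallelAt` demands,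
includes that of the base curve. -/
lemma IsParallelAt.mdifferentiableAt {cov : CovariantDerivative 𝓘(ℝ, E) E (𝓣 : M → Type _)}
    {γ : ℝ → M} {V : ∀ s, 𝓣 (γ s)} {t : ℝ} (h : IsParallelAt cov γ V t) :
    MDifferentiableAt 𝓘(ℝ, ℝ) 𝓘(ℝ, E) γ t :=
  ((mdifferentiableAt_totalSpace _ _).1 h.1).1

/-- The expansion behind `IsParallelAt`: the field `X₀` is constant in the trivialization around
`γ t`, and the other fields are a frame of that trivialization. -/
lemma IsParallelAt.hasParallelExpansion
    {cov : CovariantDerivative 𝓘(ℝ, E) E (𝓣 : M → Type _)}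
    {γ : ℝ → M} {V : ∀ s, 𝓣 (γ s)} {t : ℝ} (h : IsParallelAt cov γ V t) :
    HasParallelExpansion cov γ V t := by
  have hγ := h.mdifferentiableAt
  obtain ⟨hd, hD⟩ := h
  have hv := ((mdifferentiableAt_totalSpace _ _).1 hd).2
  set T := trivializationAt E (𝓣 : M → Type _) (γ t) with hT
  have hx : γ t ∈ T.baseSet := FiberBundle.mem_baseSet_trivializationAt' (γ t)
  set v : ℝ → E := fun s ↦ (T ⟨γ s, V s⟩).2 with hvdef
  have hv' : HasDerivAt v (deriv v t) t := (MDifferentiableAt.differentiableAt hv).hasDerivAt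
  let b := Module.finBasis ℝ E
  have hcoord (i) : HasDerivAt (fun s ↦ b.repr (v s - v t) i) (b.repr (deriv v t) i) t :=
    (LinearMap.toContinuousLinearMap (b.coord i)).hasFDerivAt.comp_hasDerivAt t
      (hv'.sub_const (v t))
  have hsum {y : M} (hy : y ∈ T.baseSet) (w : E) :
      T.symm y w = ∑ i, b.repr w i • T.symm y (b i) := by
    simp only [← T.symmL_apply (R := ℝ) hy]
    conv_lhs => rw [← b.sum_repr w, map_sum]
    simp
  refine ⟨extend E (V t), _, fun i s ↦ b.repr (v s - v t) i, fun i ↦ b.repr (deriv v t) i,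
    fun i y ↦ T.symm y (b i), contMDiffAt_extend .., fun i ↦ ?_, fun i ↦ by simp, hcoord, ?_, ?_⟩
  · have h1 : CMDiffAt ∞ (T% (extend E (T.symm (γ t) (b i)))) (γ t) := contMDiffAt_extend ..
    have h2 : extend E (T.symm (γ t) (b i)) = fun y ↦ T.symm y (b i) := by
      funext y
      rw [extend, ← hT, T.apply_mk_symm hx]
    rw [h2] at h1
    exact h1
  · filter_upwards [hγ.continuousAt.preimage_mem_nhds (T.open_baseSet.mem_nhds hx)] with s hs
    have h1 : V s = T.symm (γ s) (v s) := (T.symm_apply_apply_mk hs (V s)).symm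
    have h2 : extend E (V t) (γ s) = T.symm (γ s) (v t) := rfl
    rw [← hsum hs, h2, h1]
    simp only [← T.symmL_apply (R := ℝ) hs]
    rw [← map_add]
    congr 1
    abel
  · rw [← hsum hx, add_comm]
    exact hD

lemma HasParallelExpansion.of_parallel_field
    {cov : CovariantDerivative 𝓘(ℝ, E) E (𝓣 : M → Type _)} {γ : ℝ → M} {Y : ∀ y : M, 𝓣 y} {t : ℝ}
    (hY : CMDiffAt ∞ (T% Y) (γ t)) (h : cov Y (γ t) = 0) :
    HasParallelExpansion cov γ (fun s ↦ Y (γ s)) t :=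
  ⟨Y, 0, fun _ _ ↦ 0, fun _ ↦ 0, fun _ ↦ Y, hY, fun _ ↦ hY, fun _ ↦ rfl,
    fun i ↦ i.elim0, by simp, by simp [h]⟩

/-- A connection which preserves `J` has `D_t (J V) = J (D_t V)`. -/
lemma HasParallelExpansion.ap {S : HermitianStructure E M}
    {cov : CovariantDerivative 𝓘(ℝ, E) E (𝓣 : M → Type _)}
    (hJ : ∀ (x : M) (u : 𝓣 x) (Y : ∀ y : M, 𝓣 y), CMDiffAt ∞ (T% Y) x →
      cov (S.ap Y) x u = S.J x (cov Y x u))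
    {γ : ℝ → M} {V : ∀ s, 𝓣 (γ s)} {t : ℝ} (hV : HasParallelExpansion cov γ V t) :
    HasParallelExpansion cov γ (fun s ↦ S.J (γ s) (V s)) t := by
  obtain ⟨X₀, k, v, v', X, hX₀, hX, hv0, hv, hev, hD⟩ := hV
  refine ⟨S.ap X₀, k, v, v', fun i ↦ S.ap (X i), S.contMDiffAt_ap hX₀,
    fun i ↦ S.contMDiffAt_ap (hX i), hv0, hv, ?_, ?_⟩
  · filter_upwards [hev] with s hs
    rw [hs]
    simp [HermitianStructure.ap]
  · have h := congrArg (S.J (γ t)) hD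
    rw [hJ _ _ _ hX₀]
    simpa [HermitianStructure.ap] using h

/-- The scalar product of two parallel vector fields along a curve has derivative zero, for a metric
connection. -/
lemma HasParallelExpansion.hasDerivAt_inner
    {cov : CovariantDerivative 𝓘(ℝ, E) E (𝓣 : M → Type _)}
    (hg : ∀ (x : M) (u : 𝓣 x) (Y Z : ∀ y : M, 𝓣 y), CMDiffAt ∞ (T% Y) x → CMDiffAt ∞ (T% Z) x →
      d% (fun y ↦ inner ℝ (Y y) (Z y)) x u = inner ℝ (cov Y x u) (Z x) + inner ℝ (Y x) (cov Z x u))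
    {γ : ℝ → M} {V W : ∀ s, 𝓣 (γ s)} {t : ℝ} (hγ : MDifferentiableAt 𝓘(ℝ, ℝ) 𝓘(ℝ, E) γ t)
    (hV : HasParallelExpansion cov γ V t) (hW : HasParallelExpansion cov γ W t) :
    HasDerivAt (fun s ↦ inner ℝ (V s) (W s)) 0 t := by
  obtain ⟨X₀, k, v, v', X, hX₀, hX, hv0, hv, hVev, hVD⟩ := hV
  obtain ⟨Y₀, l, w, w', Y, hY₀, hY, hw0, hw, hWev, hWD⟩ := hW
  have hcomp {A B : ∀ y : M, 𝓣 y} (hA : ContMDiffAt 𝓘(ℝ, E) 𝓘(ℝ, E).tangent ∞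
        (fun y ↦ (⟨y, A y⟩ : TangentBundle 𝓘(ℝ, E) M)) (γ t))
      (hB : ContMDiffAt 𝓘(ℝ, E) 𝓘(ℝ, E).tangent ∞
        (fun y ↦ (⟨y, B y⟩ : TangentBundle 𝓘(ℝ, E) M)) (γ t)) :
      HasDerivAt (fun s ↦ inner ℝ (A (γ s)) (B (γ s)))
        (d% (fun y ↦ inner ℝ (A y) (B y)) (γ t) (mfderiv 𝓘(ℝ, ℝ) 𝓘(ℝ, E) γ t (1 : ℝ))) t := by
    have h1 := mdifferentiableAt_inner (hA.mdifferentiableAt (by simp))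
      (hB.mdifferentiableAt (by simp))
    have h2 : HasFDerivAt (fun s ↦ inner ℝ (A (γ s)) (B (γ s)))
        ((d% (fun y ↦ inner ℝ (A y) (B y)) (γ t)).comp (mfderiv 𝓘(ℝ, ℝ) 𝓘(ℝ, E) γ t) : ℝ →L[ℝ] ℝ)
        t := (h1.hasMFDerivAt.comp t hγ.hasMFDerivAt).hasFDerivAt
    exact h2.hasDerivAt
  have hF : (fun s ↦ inner ℝ (V s) (W s)) =ᶠ[𝓝 t] fun s ↦
      inner ℝ (X₀ (γ s)) (Y₀ (γ s)) + ∑ j, w j s * inner ℝ (X₀ (γ s)) (Y j (γ s))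
        + ∑ i, (v i s * inner ℝ (X i (γ s)) (Y₀ (γ s))
          + ∑ j, v i s * (w j s * inner ℝ (X i (γ s)) (Y j (γ s)))) := by
    filter_upwards [hVev, hWev] with s hs hs'
    rw [hs, hs']
    simp [inner_add_left, inner_add_right, sum_inner, inner_sum, inner_smul_left, inner_smul_right,
      Finset.sum_add_distrib]
    simp only [mul_add, Finset.mul_sum, Finset.sum_add_distrib]
    rw [Finset.sum_comm (f := fun j i ↦ w j s * (v i s * inner ℝ (X i (γ s)) (Y j (γ s))))]
    simp only [mul_left_comm]
    ring
  refine HasDerivAt.congr_of_eventuallyEq ?_ hF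
  -- all terms with a factor `v i t` or `w j t` drop out of the derivative, as these vanish
  have hder := ((hcomp hX₀ hY₀).add (HasDerivAt.fun_sum fun j (_ : j ∈ Finset.univ) ↦
      (hw j).mul (hcomp hX₀ (hY j)))).add
    (HasDerivAt.fun_sum fun i (_ : i ∈ Finset.univ) ↦ ((hv i).mul (hcomp (hX i) hY₀)).add
      (HasDerivAt.fun_sum fun j (_ : j ∈ Finset.univ) ↦
        (hv i).mul ((hw j).mul (hcomp (hX i) (hY j)))))
  refine hder.congr_deriv ?_
  rw [hg _ _ _ _ hX₀ hY₀, eq_neg_of_add_eq_zero_left hVD, eq_neg_of_add_eq_zero_left hWD]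
  simp [hv0, hw0, sum_inner, inner_sum, inner_smul_left, inner_smul_right]

/-! ### Parallel transport along loops -/

lemma eq_of_hasDerivAt_zero_off_finite {f : ℝ → ℝ} {s : Set ℝ} (hs : s.Finite)
    (hc : ContinuousOn f (Icc 0 1)) (hd : ∀ t ∈ Ioo (0 : ℝ) 1 \ s, HasDerivAt f 0 t) :
    f 1 = f 0 := by
  have h := MeasureTheory.integral_eq_of_hasDerivAt_off_countable f (fun _ ↦ 0) (a := 0) (b := 1)
    hs.countable (by rwa [uIcc_of_le zero_le_one]) (by simpa using hd) (by simp)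
  simp only [intervalIntegral.integral_zero] at h
  linarith

lemma isContinuousRiemannianBundle_tangent :
    IsContinuousRiemannianBundle E (fun x : M ↦ 𝓣 x) := by
  obtain ⟨g, hg, hinner⟩ := IsContMDiffRiemannianBundle.exists_contMDiff (IB := 𝓘(ℝ, E)) (n := ∞)
    (F := E) (E := fun x : M ↦ 𝓣 x)
  exact ⟨g, hg.continuous, hinner⟩

/-- Equality in the tangent bundle is used because the base points `γ 0` and `γ 1` of a loop at `p`
equal `p` only propositionally. -/
lemma inner_congr_totalSpace {x y : M} {v w : 𝓣 x} {v' w' : 𝓣 y}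
    (hv : (⟨x, v⟩ : TangentBundle 𝓘(ℝ, E) M) = ⟨y, v'⟩)
    (hw : (⟨x, w⟩ : TangentBundle 𝓘(ℝ, E) M) = ⟨y, w'⟩) :
    inner ℝ v w = inner ℝ v' w' := by
  obtain rfl : x = y := congrArg TotalSpace.proj hv
  rw [TotalSpace.mk_inj] at hv hw
  rw [hv, hw]

namespace HermitianStructure

lemma apply_congr_totalSpace (S : HermitianStructure E M) {x y : M} {v : 𝓣 x} {v' : 𝓣 y}
    (hv : (⟨x, v⟩ : TangentBundle 𝓘(ℝ, E) M) = ⟨y, v'⟩) :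
    (⟨x, S.J x v⟩ : TangentBundle 𝓘(ℝ, E) M) = ⟨y, S.J y v'⟩ := by
  obtain rfl : x = y := congrArg TotalSpace.proj hv
  rw [TotalSpace.mk_inj] at hv
  rw [hv]

variable {S : HermitianStructure E M}

/-- Scalar products of vector fields along a curve which are parallel for the Bismut connection are
constant. -/
lemma IsLeeForm.inner_eq_of_hasParallelExpansion {θ : ∀ x : M, 𝓣 x →L[ℝ] ℝ}
    (hθ : S.IsLeeForm θ) {γ : ℝ → M} {V W : ∀ s, 𝓣 (γ s)} {s : Set ℝ} (hs : s.Finite)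
    (hVc : ContinuousOn (fun s ↦ (⟨γ s, V s⟩ : TangentBundle 𝓘(ℝ, E) M)) (Icc 0 1))
    (hWc : ContinuousOn (fun s ↦ (⟨γ s, W s⟩ : TangentBundle 𝓘(ℝ, E) M)) (Icc 0 1))
    (hVW : ∀ t ∈ Ioo (0 : ℝ) 1 \ s, MDifferentiableAt 𝓘(ℝ, ℝ) 𝓘(ℝ, E) γ t ∧
      HasParallelExpansion S.bismut γ V t ∧ HasParallelExpansion S.bismut γ W t) :
    inner ℝ (V 1) (W 1) = inner ℝ (V 0) (W 0) := by
  have := isContinuousRiemannianBundle_tangent (E := E) (M := M)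
  refine eq_of_hasDerivAt_zero_off_finite (f := fun t ↦ inner ℝ (V t) (W t)) hs
    (ContinuousOn.inner_bundle (F := E) (E := fun x : M ↦ 𝓣 x) hVc hWc) fun t ht ↦ ?_
  obtain ⟨hγ, hV, hW⟩ := hVW t ht
  exact hV.hasDerivAt_inner (fun x u Y Z hY hZ ↦ hθ.bismut_metric u hY hZ) hγ hW

lemma IsLeeForm.inner_of_mem_holonomy {θ : ∀ x : M, 𝓣 x →L[ℝ] ℝ}
    (hθ : S.IsLeeForm θ) {p : M} {P : 𝓣 p ≃L[ℝ] 𝓣 p} (hP : P ∈ holonomy S.bismut p) (v w : 𝓣 p) :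
    inner ℝ (P v) (P w) = inner ℝ v w := by
  obtain ⟨γ, -, hγ⟩ := hP
  obtain ⟨V, ⟨hVc, hVf⟩, hV0, hV1⟩ := hγ v
  obtain ⟨W, ⟨hWc, hWf⟩, hW0, hW1⟩ := hγ w
  rw [← inner_congr_totalSpace hV0 hW0, ← inner_congr_totalSpace hV1 hW1]
  refine hθ.inner_eq_of_hasParallelExpansion (hVf.union hWf) hVc hWc fun t ht ↦ ?_
  have hV : IsParallelAt S.bismut γ V t := by
    by_contra h
    exact ht.2 (.inl ⟨ht.1, h⟩)
  have hW : IsParallelAt S.bismut γ W t := by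
    by_contra h
    exact ht.2 (.inr ⟨ht.1, h⟩)
  exact ⟨hV.mdifferentiableAt, hV.hasParallelExpansion, hW.hasParallelExpansion⟩

/-- Parallel transport along loops preserves `ω`, as `J V` is parallel when `V` is. -/
lemma IsLeeForm.inner_J_of_mem_holonomy {θ : ∀ x : M, 𝓣 x →L[ℝ] ℝ}
    (hθ : S.IsLeeForm θ) {p : M} {P : 𝓣 p ≃L[ℝ] 𝓣 p} (hP : P ∈ holonomy S.bismut p) (v w : 𝓣 p) :
    inner ℝ (S.J p (P v)) (P w) = inner ℝ (S.J p v) w := by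
  obtain ⟨γ, -, hγ⟩ := hP
  obtain ⟨V, ⟨hVc, hVf⟩, hV0, hV1⟩ := hγ v
  obtain ⟨W, ⟨hWc, hWf⟩, hW0, hW1⟩ := hγ w
  rw [← inner_congr_totalSpace (S.apply_congr_totalSpace hV0) hW0,
    ← inner_congr_totalSpace (S.apply_congr_totalSpace hV1) hW1]
  have hγc : ContinuousOn γ (Icc 0 1) :=
    (FiberBundle.continuous_proj E (𝓣 : M → Type _)).comp_continuousOn hVc
  refine hθ.inner_eq_of_hasParallelExpansion (V := fun s ↦ S.J (γ s) (V s)) (hVf.union hWf)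
    (ContinuousOn.clm_bundle_apply (F₁ := E) (F₂ := E) (E₁ := fun x : M ↦ 𝓣 x)
      (E₂ := fun x : M ↦ 𝓣 x) (b := γ) (S.smooth.continuous.comp_continuousOn hγc) hVc)
    hWc fun t ht ↦ ?_
  have hV : IsParallelAt S.bismut γ V t := by
    by_contra h
    exact ht.2 (.inl ⟨ht.1, h⟩)
  have hW : IsParallelAt S.bismut γ W t := by
    by_contra h
    exact ht.2 (.inr ⟨ht.1, h⟩)
  exact ⟨hV.mdifferentiableAt,
    hV.hasParallelExpansion.ap fun x u Y hY ↦ hθ.bismut_ap u hY, hW.hasParallelExpansion⟩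

lemma IsLeeForm.map_J_of_mem_holonomy {θ : ∀ x : M, 𝓣 x →L[ℝ] ℝ}
    (hθ : S.IsLeeForm θ) {p : M} {P : 𝓣 p ≃L[ℝ] 𝓣 p} (hP : P ∈ holonomy S.bismut p) (v : 𝓣 p) :
    P (S.J p v) = S.J p (P v) := by
  refine ext_inner_right ℝ fun w ↦ ?_
  obtain ⟨w, rfl⟩ := P.surjective w
  rw [hθ.inner_of_mem_holonomy hP, hθ.inner_J_of_mem_holonomy hP]

/-- Parallel transport along a loop fixes the Lee vector: the scalar product of the parallel Lee
field with an arbitrary parallel field along the loop is constant. -/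
lemma IsVaisman.map_leeField_of_mem_holonomy {θ : ∀ x : M, 𝓣 x →L[ℝ] ℝ}
    (hθ : S.IsVaisman θ) {p : M} {P : 𝓣 p ≃L[ℝ] 𝓣 p} (hP : P ∈ holonomy S.bismut p) :
    P (sharp p (θ p)) = sharp p (θ p) := by
  refine ext_inner_right ℝ fun w ↦ ?_
  obtain ⟨w, rfl⟩ := P.surjective w
  rw [hθ.isLeeForm.inner_of_mem_holonomy hP]
  obtain ⟨γ, -, hγ⟩ := hP
  obtain ⟨W, ⟨hWc, hWf⟩, hW0, hW1⟩ := hγ w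
  have hA {x y : M} (h : x = y) :
      (⟨x, sharp x (θ x)⟩ : TangentBundle 𝓘(ℝ, E) M) = ⟨y, sharp y (θ y)⟩ := by rw [h]
  rw [← inner_congr_totalSpace (hA (congrArg TotalSpace.proj hW0)) hW0,
    ← inner_congr_totalSpace (hA (congrArg TotalSpace.proj hW1)) hW1]
  have hγc : ContinuousOn γ (Icc 0 1) :=
    (FiberBundle.continuous_proj E (𝓣 : M → Type _)).comp_continuousOn hWc
  have hAc : ContMDiff 𝓘(ℝ, E) 𝓘(ℝ, E).tangent ∞
      (fun y ↦ (⟨y, sharp y (θ y)⟩ : TangentBundle 𝓘(ℝ, E) M)) := hθ.contMDiffAt_leeField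
  refine (hθ.isLeeForm.inner_eq_of_hasParallelExpansion (V := fun s ↦ sharp (γ s) (θ (γ s))) hWf
    (hAc.continuous.comp_continuousOn hγc) hWc fun t ht ↦ ?_).symm
  have hW : IsParallelAt S.bismut γ W t := by
    by_contra h
    exact ht.2 ⟨ht.1, h⟩
  exact ⟨hW.mdifferentiableAt, .of_parallel_field (hθ.contMDiffAt_leeField _)
    (ContinuousLinearMap.ext fun u ↦ hθ.bismut_leeField _ u), hW.hasParallelExpansion⟩

end HermitianStructure

/-! ### Unitary frames adapted to a unit vector -/

/-- A Hermitian real vector space of dimension `2n` is identified with `ℂ × ℂⁿ⁻¹` in such a way that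
a given unit vector becomes the first basis vector. The scalar product is given as a bare function
`g`, so that no norm on `V` competes with that of the complex inner product space built here. -/
lemma exists_unitary_equiv_of_unit {V : Type*} [AddCommGroup V] [Module ℝ V]
    (hfin : FiniteDimensional ℝ V) {n : ℕ} (hn : Module.finrank ℝ V = 2 * n) (J : V →ₗ[ℝ] V)
    (hJ : ∀ v, J (J v) = -v) (g : V → V → ℝ) (hadd : ∀ u v w, g (u + v) w = g u w + g v w)
    (hsmul : ∀ (r : ℝ) v w, g (r • v) w = r * g v w) (hsymm : ∀ v w, g v w = g w v)
    (hpos : ∀ v, v ≠ 0 → 0 < g v v) (hgJ : ∀ v w, g (J v) (J w) = g v w) {e : V} (he : g e e = 1) :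
    ∃ φ : V ≃ₗ[ℝ] EuclideanSpace ℂ (Unit ⊕ Fin (n - 1)),
      (∀ v, φ (J v) = Complex.I • φ v) ∧ (∀ v w, (inner ℂ (φ v) (φ w)).re = g v w) ∧
      φ e = EuclideanSpace.single (Sum.inl ()) 1 := by
  have hJJ : J * J = -1 := LinearMap.ext fun v ↦ by simpa using hJ v
  -- the complex vector space in which `J` is multiplication by `i`
  let _ : Module ℂ V := Module.compHom V (Complex.liftAux J hJJ).toRingHom
  have smul_def (z : ℂ) (v : V) : z • v = z.re • v + z.im • J v := by
    change (Complex.liftAux J hJJ) z v = _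
    simp [Complex.liftAux_apply, Algebra.algebraMap_eq_smul_one]
  have : IsScalarTower ℝ ℂ V := ⟨fun r z v ↦ by simp [smul_def, mul_smul]⟩
  have hneg (v w : V) : g (-v) w = -g v w := by
    rw [← neg_one_smul ℝ v, hsmul, neg_one_mul]
  have hskew (v w : V) : g (J v) w = -g v (J w) := by
    rw [← hgJ v (J w), hJ, hsymm (J v) (-w), hneg, hsymm w, neg_neg]
  have h0 : g 0 0 = 0 := by simpa using hsmul 0 0 0
  have hnonneg (v : V) : 0 ≤ g v v := by
    by_cases hv : v = 0
    · rw [hv, h0]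
    · exact (hpos v hv).le
  -- the Hermitian form with real part `g`, complex linear in the second argument
  let core : InnerProductSpace.Core ℂ V :=
    { inner := fun v w ↦ ⟨g v w, g (J v) w⟩
      conj_inner_symm := fun v w ↦ by
        apply Complex.ext
        · simp [hsymm v]
        · simp [hskew w v, hsymm w]
      re_inner_nonneg := fun v ↦ hnonneg v
      add_left := fun u v w ↦ by apply Complex.ext <;> simp [hadd]
      smul_left := fun v w z ↦ by
        apply Complex.ext
        · simp [smul_def, hadd, hsmul]
        · simp [smul_def, hJ, hadd, hsmul, hneg]
      definite := fun v hv ↦ by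
        by_contra h
        exact (hpos v h).ne' (congrArg Complex.re hv) }
  let _ : NormedAddCommGroup V := core.toNormedAddCommGroup
  let _ : InnerProductSpace ℂ V := InnerProductSpace.ofCore core.toCore
  have he0 : e ≠ 0 := fun h ↦ by simp [h, h0] at he
  have : FiniteDimensional ℂ V := FiniteDimensional.right ℝ ℂ V
  have hdim : Module.finrank ℂ V = n := by
    have h := Module.finrank_mul_finrank ℝ ℂ V
    rw [Complex.finrank_real_complex, hn] at h
    linarith
  have hn0 : 0 < n := by
    rw [← hdim]
    have : Nontrivial V := ⟨e, 0, he0⟩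
    exact Module.finrank_pos
  have hcard : Module.finrank ℂ V = Fintype.card (Unit ⊕ Fin (n - 1)) := by
    rw [hdim, Fintype.card_sum, Fintype.card_unit, Fintype.card_fin]
    omega
  have hnorm : ‖e‖ = 1 := by
    rw [norm_eq_sqrt_re_inner (𝕜 := ℂ)]
    change √(g e e) = 1
    rw [he, Real.sqrt_one]
  have ho : Orthonormal ℂ (({Sum.inl ()} : Set (Unit ⊕ Fin (n - 1))).domRestrict fun _ ↦ e) :=
    ⟨fun _ ↦ hnorm, fun i j hij ↦ absurd (Subsingleton.elim i j) hij⟩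
  obtain ⟨b, hb⟩ := ho.exists_orthonormalBasis_extension_of_card_eq hcard
  refine ⟨b.repr.toLinearEquiv.restrictScalars ℝ, fun v ↦ ?_, fun v w ↦ ?_, ?_⟩
  · have h : J v = Complex.I • v := by simp [smul_def]
    rw [h]
    exact b.repr.map_smul _ _
  · exact congrArg Complex.re (b.repr.inner_map_map v w)
  · have h := hb (Sum.inl ()) rfl
    change b.repr e = _
    rw [← h, b.repr_self]

/-- A unitary map which fixes the first basis vector has a matrix of the form `diag(1, B)`. -/
lemma exists_eq_diagOne {m : ℕ}
    (U : EuclideanSpace ℂ (Unit ⊕ Fin m) →ₗ[ℂ] EuclideanSpace ℂ (Unit ⊕ Fin m))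
    (hU : ∀ v w, inner ℂ (U v) (U w) = inner ℂ v w)
    (he : U (EuclideanSpace.single (Sum.inl ()) 1) = EuclideanSpace.single (Sum.inl ()) 1) :
    ∃ B : Matrix.unitaryGroup (Fin m) ℂ, ∀ v, U v = Matrix.toEuclideanLin (diagOne B) v := by
  -- the image of every other basis vector is orthogonal to that of the first, which is fixed
  have hrow (j : Fin m) : U (EuclideanSpace.single (Sum.inr j) 1) (Sum.inl ()) = 0 := by
    have h := hU (EuclideanSpace.single (Sum.inl ()) 1) (EuclideanSpace.single (Sum.inr j) 1)
    rw [he] at h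
    simpa [EuclideanSpace.inner_single_left] using h
  let B : Matrix (Fin m) (Fin m) ℂ :=
    Matrix.of fun i j ↦ U (EuclideanSpace.single (Sum.inr j) 1) (Sum.inr i)
  have hB : B ∈ Matrix.unitaryGroup (Fin m) ℂ := by
    rw [Matrix.mem_unitaryGroup_iff']
    ext j k
    have h := hU (EuclideanSpace.single (Sum.inr j) 1) (EuclideanSpace.single (Sum.inr k) 1)
    rw [PiLp.inner_apply, Fintype.sum_sum_type, EuclideanSpace.inner_single_left] at h
    simp [hrow] at h
    simp [Matrix.mul_apply, B, Matrix.star_apply, Matrix.one_apply, mul_comm, h]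
  refine ⟨⟨B, hB⟩, fun v ↦ ?_⟩
  have hv : v = ∑ i, v i • EuclideanSpace.single i (1 : ℂ) := by
    simpa only [EuclideanSpace.basisFun_repr, EuclideanSpace.basisFun_apply] using
      ((EuclideanSpace.basisFun (Unit ⊕ Fin m) ℂ).sum_repr v).symm
  conv_lhs => rw [hv, map_sum, Fintype.sum_sum_type]
  ext i
  rcases i with i | i
  · simp [diagOne, Matrix.toLpLin_apply, he, hrow, Matrix.mulVec, dotProduct]
  · simp [diagOne, Matrix.toLpLin_apply, he, Matrix.mulVec, dotProduct, B, mul_comm]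

lemma map_complex_smul {ι : Type*} [Fintype ι]
    (K : EuclideanSpace ℂ ι →ₗ[ℝ] EuclideanSpace ℂ ι)
    (hK : ∀ z, K (Complex.I • z) = Complex.I • K z) (c : ℂ) (z : EuclideanSpace ℂ ι) :
    K (c • z) = c • K z := by
  have h (w : EuclideanSpace ℂ ι) : c • w = c.re • w + c.im • Complex.I • w := by
    conv_lhs => rw [← Complex.re_add_im c, add_smul, mul_smul]
    rfl
  rw [h, h, map_add, map_smul, map_smul, hK]

/-- For complex linear maps it is enough to preserve the real part of the inner product. -/
lemma inner_map_map_of_re {W : Type*} [NormedAddCommGroup W] [InnerProductSpace ℂ W]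
    (U : W →ₗ[ℂ] W) (hU : ∀ v w, (inner ℂ (U v) (U w)).re = (inner ℂ v w).re) (v w : W) :
    inner ℂ (U v) (U w) = inner ℂ v w := by
  apply Complex.ext (hU v w)
  have h := hU (Complex.I • v) w
  simpa [map_smul, inner_smul_left] using h

namespace HermitianStructure

lemma exists_isUnitaryFrame (S : HermitianStructure E M) {n : ℕ}
    (hn : Module.finrank ℝ E = 2 * n) {p : M} {e : 𝓣 p} (he : inner ℝ e e = 1) :
    ∃ φ : 𝓣 p ≃ₗ[ℝ] EuclideanSpace ℂ (Unit ⊕ Fin (n - 1)),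
      S.IsUnitaryFrame p φ ∧ φ e = EuclideanSpace.single (Sum.inl ()) 1 := by
  obtain ⟨φ, hφJ, hφg, hφe⟩ := exists_unitary_equiv_of_unit (V := 𝓣 p)
    (inferInstanceAs (FiniteDimensional ℝ E)) hn
    (S.J p).toLinearMap (S.J_J p) (fun v w ↦ inner ℝ v w)
    inner_add_left (fun r v w ↦ real_inner_smul_left v w r)
    (fun v w ↦ real_inner_comm w v) (fun v hv ↦ real_inner_self_pos.2 hv) (S.inner_J_J p) he
  exact ⟨φ, ⟨hφJ, hφg⟩, hφe⟩

/-- In a unitary frame, a real linear isometry which commutes with `J` and fixes the first basis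
vector becomes a matrix `diag(1, B)`. -/
lemma IsUnitaryFrame.exists_eq_diagOne {S : HermitianStructure E M} {m : ℕ} {p : M}
    {φ : 𝓣 p ≃ₗ[ℝ] EuclideanSpace ℂ (Unit ⊕ Fin m)} (hφ : S.IsUnitaryFrame p φ)
    {P : 𝓣 p ≃L[ℝ] 𝓣 p} (hPg : ∀ v w, inner ℝ (P v) (P w) = inner ℝ v w)
    (hPJ : ∀ v, P (S.J p v) = S.J p (P v)) {e : 𝓣 p} (hPe : P e = e)
    (hφe : φ e = EuclideanSpace.single (Sum.inl ()) 1) :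
    ∃ B : Matrix.unitaryGroup (Fin m) ℂ,
      ∀ v, φ (P v) = Matrix.toEuclideanLin (diagOne B) (φ v) := by
  -- `P` in the frame `φ`, first as a real linear map, then as a complex linear one
  let K : EuclideanSpace ℂ (Unit ⊕ Fin m) →ₗ[ℝ] EuclideanSpace ℂ (Unit ⊕ Fin m) :=
    φ.toLinearMap ∘ₗ P.toLinearEquiv.toLinearMap ∘ₗ φ.symm.toLinearMap
  have hK (v : 𝓣 p) : K (φ v) = φ (P v) := by simp [K]
  have hKI (z : EuclideanSpace ℂ (Unit ⊕ Fin m)) : K (Complex.I • z) = Complex.I • K z := by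
    obtain ⟨v, rfl⟩ := φ.surjective z
    rw [← hφ.map_J, hK, hK, hPJ, hφ.map_J]
  let U : EuclideanSpace ℂ (Unit ⊕ Fin m) →ₗ[ℂ] EuclideanSpace ℂ (Unit ⊕ Fin m) :=
    { toFun := K
      map_add' := K.map_add
      map_smul' := map_complex_smul K hKI }
  have hUK (v : 𝓣 p) : U (φ v) = φ (P v) := hK v
  obtain ⟨B, hB⟩ := BismutVaisman.exists_eq_diagOne U
    (inner_map_map_of_re U fun z w ↦ by
      obtain ⟨v, rfl⟩ := φ.surjective z
      obtain ⟨w, rfl⟩ := φ.surjective w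
      rw [hUK, hUK, hφ.re_inner, hφ.re_inner, hPg])
    (by rw [← hφe, hUK, hPe])
  exact ⟨B, fun v ↦ by rw [← hB, hUK]⟩

end HermitianStructure

end

end BismutVaisman

open BismutVaisman HermitianStructure

theorem mainTheorem1 {E : Type*} [NormedAddCommGroup E] [NormedSpace ℝ E] [FiniteDimensional ℝ E]
    {M : Type*} [TopologicalSpace M] [ChartedSpace E M] [IsManifold 𝓘(ℝ, E) ∞ M]
    [ConnectedSpace M]
    [RiemannianBundle (fun x : M ↦ TangentSpace 𝓘(ℝ, E) x)]
    [IsContMDiffRiemannianBundle 𝓘(ℝ, E) ∞ E (fun x : M ↦ TangentSpace 𝓘(ℝ, E) x)]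
    (n : ℕ) (hn : Module.finrank ℝ E = 2 * n)
    (S : HermitianStructure E M) (θ : ∀ x : M, TangentSpace 𝓘(ℝ, E) x →L[ℝ] ℝ)
    (hθ : S.IsVaisman θ) (hθ_ne : ∃ x, θ x ≠ 0) :
    (∀ (x : M) (u : TangentSpace 𝓘(ℝ, E) x),
      S.bismut (fun y ↦ sharp y (θ y)) x u = 0 ∧
      S.bismut (fun y ↦ S.J y (sharp y (θ y))) x u = 0) ∧
    ∀ p : M, ∃ φ : TangentSpace 𝓘(ℝ, E) p ≃ₗ[ℝ] EuclideanSpace ℂ (Unit ⊕ Fin (n - 1)),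
      S.IsUnitaryFrame p φ ∧
      ∀ P ∈ holonomy S.bismut p, ∃ B : Matrix.unitaryGroup (Fin (n - 1)) ℂ,
        ∀ v, φ (P v) = Matrix.toEuclideanLin (diagOne B) (φ v) := by
  refine ⟨fun x u ↦ ⟨hθ.bismut_leeField x u, hθ.bismut_J_leeField x u⟩, fun p ↦ ?_⟩
  set A := sharp p (θ p) with hA
  have hA0 : A ≠ 0 := hθ.leeField_ne_zero hθ_ne p
  -- the unit vector in the direction of `A` becomes the first vector of the frame
  have he : inner ℝ (‖A‖⁻¹ • A) (‖A‖⁻¹ • A) = 1 := by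
    rw [real_inner_self_eq_norm_sq, norm_smul, norm_inv, norm_norm,
      inv_mul_cancel₀ (norm_ne_zero_iff.2 hA0), one_pow]
  obtain ⟨φ, hφ, hφe⟩ := S.exists_isUnitaryFrame hn he
  refine ⟨φ, hφ, fun P hP ↦ hφ.exists_eq_diagOne (hθ.isLeeForm.inner_of_mem_holonomy hP)
    (hθ.isLeeForm.map_J_of_mem_holonomy hP) ?_ hφe⟩
  rw [map_smul, hA, hθ.map_leeField_of_mem_holonomy hP]
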